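/- An interval Markov decision process (IMDP) is a tuple $(S,A,AP,L,I)$ with finite sets $S$ of states, $A$ of actions and $AP$ of atomic propositions, a labelling $L:S\to 2^{AP}$, and a function $I$ assigning to each $(s,a,s')\in S\times A\times S$ a subinterval $I(s,a,s')$ of $[0,1]$, such that for all $s\in S$, $a\in A$ the set $U(s,a)$ of feasible distributions, i.e. of probability distributions $\mu$ on $S$ with $\mu(s')\in I(s,a,s')$ for every $s'\in S$, is non-empty. Write $\Delta(A)$ for the set of probability distributions on $A$. A scheduler $\sigma$ assigns to each finite path (non-empty finite sequence of states) $\omega$ an element $\sigma(\omega)\in\Delta(A)$; a nature $\pi$ assigns to each finite path $\omega$ and each action $a$ an element $\pi(\omega,a)\in U(\mathrm{last}(\omega),a)$. For $s\in S$, let $\Pr_s^{\sigma,\pi}$ be the unique probability measure on the infinite paths $S^{\mathbb N}$ (with the $\sigma$-algebra generated by the cylinders $\mathrm{Cyl}(\omega)$, the sets of infinite paths with finite prefix $\omega$) such that $\Pr_s^{\sigma,\pi}[\mathrm{Cyl}(s')]$ is $1$ if $s'=s$ and $0$ otherwise, and $\Pr_s^{\sigma,\pi}[\mathrm{Cyl}(\omega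 s')]=\Pr_s^{\sigma,\pi}[\mathrm{Cyl}(\omega)]\cdot\sum_{a\in A}\sigma(\omega)(a)\,\pi(\omega,a)(s')$. PCTL state formulas $\varphi$ and path formulas $\psi$ are given by $$\varphi::=\mathit{true}\mid x\mid\neg\varphi\mid\varphi_1\wedge\varphi_2\mid \mathsf P_{\bowtie p}(\psi),\qquad \psi::=\mathsf X\varphi\mid\varphi_1\mathsf U\varphi_2\mid\varphi_1\mathsf U^{\le k}\varphi_2,$$ where $x\in AP$, $p\in[0,1]\cap\mathbb Q$, ${\bowtie}\in\{\le,<,\ge,>\}$ and $k\in\{0,1,2,\dots\}$. The satisfaction relation $\models$ is as usual for $\mathit{true}$, $\neg$, $\wedge$, with $s\models x$ iff $x\in L(s)$, and $$s\models\mathsf P_{\bowtie p}(\psi)\iff \exists\,\text{scheduler }\sigma\ \ \forall\,\text{nature }\pi:\ \Pr_s^{\sigma,\pi}\bigl[\{w : w\models\psi\}\bigr]\bowtie p .$$ For an infinite path $w=w_0w_1w_2\cdots$: $w\models\mathsf X\varphi$ iff $w_1\models\varphi$; $w\models\varphi_1\mathsf U^{\le k}\varphi_2$ iff there is $i\le k$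 with $w_i\models\varphi_2$ and $w_j\models\varphi_1$ for all $0\le j<i$; $w\models\varphi_1\mathsf U\varphi_2$ iff $w\models\varphi_1\mathsf U^{\le k}\varphi_2$ for some $k$. For $\rho\in\Delta(A)$ write $s\xrightarrow{\rho}\mu$ if $\mu=\sum_{a\in A}\rho(a)\mu_a$ for some $\mu_a\in U(s,a)$ ($a\in A$). An equivalence relation $R$ on $S$ is a probabilistic $(\exists\sigma\forall)$-bisimulation if for every $(s,t)\in R$ we have $L(s)=L(t)$, and for each $\rho_s\in\Delta(A)$ there is $\rho_t\in\Delta(A)$ such that for each $\nu$ with $t\xrightarrow{\rho_t}\nu$ there is $\mu$ with $s\xrightarrow{\rho_s}\mu$ and $\mu(C)=\nu(C)$ for each equivalence class $C$ of $R$. Write $s\sim_{(\exists\sigma\forall)}t$ if $(s,t)\in R$ for some such $R$. **Theorem.** Let $s,t$ be states of an IMDP with $s\sim_{(\exists\sigma\forall)}t$. Then for every PCTL state formula $\varphi$, we have $s\models\varphi$ if and only if $t\models\varphi$. -/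

import Mathlib

open MeasureTheory ProbabilityTheory

/-- A finite path: a nonempty finite sequence of states `ω 0, …, ω n`. -/
abbrev FinPath (S : Type*) : Type _ := Σ n : ℕ, (Fin (n + 1) → S)

namespace FinPath

/-- The last state of a finite path. -/
def last {S : Type*} (ω : FinPath S) : S := ω.2 (Fin.last ω.1)

/-- The finite path `ω s'`. -/
def snoc {S : Type*} (ω : FinPath S) (s' : S) : FinPath S :=
  ⟨ω.1 + 1, Fin.snoc (α := fun _ => S) ω.2 s'⟩

/-- The set of infinite paths that have the finite prefix `ω`. -/
def cylinder {S : Type*} (ω : FinPath S) : Set (ℕ → S) := {w | ∀ i : Fin (ω.1 + 1), w i = ω.2 i}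

end FinPath

/-- An interval Markov decision process with finite state space `S`, finite action set `A` and
atomic propositions `AP`. Probability distributions over a finite set `X` are the elements of
`stdSimplex ℝ X`. The intervals may be open, closed or half-open. -/
structure IMDP (S A AP : Type*) [Fintype S] where
  /-- labelling function -/
  label : S → Set AP
  /-- interval transition probability function -/
  interval : S → A → S → Set ℝ
  interval_ordConnected : ∀ s a s', (interval s a s').OrdConnected
  interval_subset : ∀ s a s', interval s a s' ⊆ Set.Icc 0 1
  feasible_nonempty : ∀ s a, {μ : S → ℝ | μ ∈ stdSimplex ℝ S ∧ ∀ s', μ s' ∈ interval s a s'}.Nonempty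

/-- Comparison symbols of the probabilistic operator. -/
inductive Comparison where
  | le | lt | ge | gt

/-- `r.Rel x p` is the comparison `x ⋈ p`. -/
def Comparison.Rel : Comparison → ℝ → ℝ → Prop
  | .le, x, p => x ≤ p
  | .lt, x, p => x < p
  | .ge, x, p => x ≥ p
  | .gt, x, p => x > p

/-- The two syntactic categories of PCTL. -/
inductive FormulaKind where
  | state | path

/-- PCTL formulas: `PCTL AP .state` are the state formulas and `PCTL AP .path` the path formulas. -/
inductive PCTL (AP : Type*) : FormulaKind → Type _ where
  | tt : PCTL AP .state
  | atom (x : AP) : PCTL AP .state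
  | neg (φ : PCTL AP .state) : PCTL AP .state
  | and (φ₁ φ₂ : PCTL AP .state) : PCTL AP .state
  | prob (r : Comparison) (p : Set.Icc (0 : ℚ) 1) (ψ : PCTL AP .path) : PCTL AP .state
  | next (φ : PCTL AP .state) : PCTL AP .path
  | til (φ₁ φ₂ : PCTL AP .state) : PCTL AP .path
  | boundedTil (k : ℕ) (φ₁ φ₂ : PCTL AP .state) : PCTL AP .path

/-- What a formula is evaluated on: states for state formulas, infinite paths for path formulas. -/
def FormulaKind.Domain (S : Type*) : FormulaKind → Type _
  | .state => S
  | .path => ℕ → S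

namespace IMDP

variable {S A AP : Type*} [Fintype S]

/-- The set of feasible distributions for state `s` and action `a`. -/
def feasible (M : IMDP S A AP) (s : S) (a : A) : Set (S → ℝ) :=
  {μ | μ ∈ stdSimplex ℝ S ∧ ∀ s', μ s' ∈ M.interval s a s'}

/-- Schedulers: history-dependent and randomised. -/
abbrev Scheduler [Fintype A] (_M : IMDP S A AP) : Type _ := FinPath S → stdSimplex ℝ A

/-- Natures: history-dependent choices of a feasible distribution for every action. -/
abbrev Nature (M : IMDP S A AP) : Type _ := (ω : FinPath S) → (a : A) → M.feasible ω.last a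

variable [Fintype A]

/-- The probability of moving from the finite path `ω` to the state `s'`. -/
def stepProb (M : IMDP S A AP) (σ : M.Scheduler) (π : M.Nature) (ω : FinPath S) (s' : S) : ℝ :=
  ∑ a, (σ ω).1 a * (π ω a).1 s'

lemma stepProb_nonneg (M : IMDP S A AP) (σ : M.Scheduler) (π : M.Nature) (ω : FinPath S) (s' : S) :
    0 ≤ M.stepProb σ π ω s' :=
  Finset.sum_nonneg fun a _ => mul_nonneg ((σ ω).2.1 a) ((π ω a).2.1.1 s')

lemma sum_stepProb (M : IMDP S A AP) (σ : M.Scheduler) (π : M.Nature) (ω : FinPath S) :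
    ∑ s', M.stepProb σ π ω s' = 1 := by
  unfold stepProb
  rw [Finset.sum_comm]
  simp_rw [← Finset.mul_sum, (π ω _).2.1.2, mul_one]
  exact (σ ω).2.2

section Measure

variable [MeasurableSpace S] [DiscreteMeasurableSpace S]

/-- The distribution of the next state after the finite path `ω`, as a measure. -/
noncomputable def stepMeasure (M : IMDP S A AP) (σ : M.Scheduler) (π : M.Nature) (ω : FinPath S) :
    Measure S :=
  ∑ s', ENNReal.ofReal (M.stepProb σ π ω s') • Measure.dirac s'

instance (M : IMDP S A AP) (σ : M.Scheduler) (π : M.Nature) (ω : FinPath S) :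
    IsProbabilityMeasure (M.stepMeasure σ π ω) := by
  constructor
  simp only [stepMeasure, Measure.coe_finsetSum, Finset.sum_apply, Measure.smul_apply,
    measure_univ, smul_eq_mul, mul_one]
  rw [← ENNReal.ofReal_sum_of_nonneg fun s' _ => M.stepProb_nonneg σ π ω s', M.sum_stepProb]
  simp

/-- The transition kernel from histories of length `n + 1` to the next state. -/
noncomputable def stepKernel (M : IMDP S A AP) (σ : M.Scheduler) (π : M.Nature) (n : ℕ) :
    Kernel ((_ : Finset.Iic n) → S) S where
  toFun x := M.stepMeasure σ π ⟨n, fun i => x ⟨i, Finset.mem_Iic.2 (Nat.lt_succ_iff.1 i.2)⟩⟩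
  measurable' := Measurable.of_discrete

instance (M : IMDP S A AP) (σ : M.Scheduler) (π : M.Nature) (n : ℕ) :
    IsMarkovKernel (M.stepKernel σ π n) :=
  ⟨fun x => inferInstanceAs (IsProbabilityMeasure
    (M.stepMeasure σ π ⟨n, fun i => x ⟨i, Finset.mem_Iic.2 (Nat.lt_succ_iff.1 i.2)⟩⟩))⟩

/-- The probability measure on infinite paths (with the product σ-algebra, i.e. the one generated
by the cylinders) for initial state `s`, scheduler `σ` and nature `π`, obtained by the
Ionescu-Tulcea extension theorem; see `pathMeasure_cylinder_zero`, `pathMeasure_cylinder_snoc`. -/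
noncomputable def pathMeasure (M : IMDP S A AP) (s : S) (σ : M.Scheduler) (π : M.Nature) :
    Measure (ℕ → S) :=
  Kernel.traj (X := fun _ => S) (M.stepKernel σ π) 0 (fun _ => s)

instance (M : IMDP S A AP) (s : S) (σ : M.Scheduler) (π : M.Nature) :
    IsProbabilityMeasure (M.pathMeasure s σ π) := by
  unfold pathMeasure; infer_instance

open Classical in
lemma pathMeasure_cylinder_zero (M : IMDP S A AP) (s : S) (σ : M.Scheduler) (π : M.Nature)
    (ω : Fin 1 → S) :
    (M.pathMeasure s σ π).real (FinPath.cylinder ⟨0, ω⟩) = if s = ω 0 then 1 else 0 := by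
  have h := Kernel.traj_map_frestrictLe_apply (X := fun _ => S) (κ := M.stepKernel σ π) 0 0
    (fun _ => s)
  have hset : FinPath.cylinder ⟨0, ω⟩
      = Preorder.frestrictLe (π := fun _ => S) 0 ⁻¹' {x | x ⟨0, by simp⟩ = ω 0} := by
    ext w
    simp [FinPath.cylinder, Fin.forall_fin_one]
  rw [hset, Measure.real, ← Measure.map_apply (Preorder.measurable_frestrictLe 0) (by measurability),
    pathMeasure, h]
  rw [Kernel.partialTraj_self, Kernel.id_apply, Measure.dirac_apply' _ (by measurability)]
  by_cases hs : s = ω 0 <;> simp [hs]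

lemma pathMeasure_cylinder_snoc (M : IMDP S A AP) (s : S) (σ : M.Scheduler) (π : M.Nature)
    (ω : FinPath S) (s' : S) :
    (M.pathMeasure s σ π).real (ω.snoc s').cylinder =
      (M.pathMeasure s σ π).real ω.cylinder * ∑ a, (σ ω).1 a * (π ω a).1 s' := by
  obtain ⟨n, f⟩ := ω
  let x : (_ : Finset.Iic n) → S := fun i => f ⟨i, Nat.lt_succ_iff.2 (Finset.mem_Iic.1 i.2)⟩
  have h := Kernel.partialTraj_compProd_eq_map_traj (X := fun _ => S) (κ := M.stepKernel σ π)
    (Nat.zero_le n) (x₀ := fun _ => s)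
  have h0 := Kernel.traj_map_frestrictLe_apply (X := fun _ => S) (κ := M.stepKernel σ π) 0 n
    (fun _ => s)
  have hx : ∀ w : ℕ → S, Preorder.frestrictLe (π := fun _ => S) n w = x ↔
      ∀ i : Fin (n + 1), w i = f i := by
    intro w
    constructor
    · intro hw i
      have := congrFun hw ⟨i, Finset.mem_Iic.2 (Nat.lt_succ_iff.1 i.2)⟩
      simpa [x] using this
    · intro hw
      funext i
      exact hw ⟨i, Nat.lt_succ_iff.2 (Finset.mem_Iic.1 i.2)⟩
  have hset0 : FinPath.cylinder ⟨n, f⟩ = Preorder.frestrictLe (π := fun _ => S) n ⁻¹' {x} := by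
    ext w
    exact (hx w).symm
  have hset : (FinPath.snoc ⟨n, f⟩ s').cylinder =
      (fun w : ℕ → S => (Preorder.frestrictLe (π := fun _ => S) n w, w (n + 1))) ⁻¹'
        ({x} ×ˢ {s'}) := by
    ext w
    simp only [FinPath.cylinder, FinPath.snoc, Set.mem_ofPred_eq, Set.mem_preimage, Set.mem_prod,
      Set.mem_singleton_iff, hx]
    rw [Fin.forall_fin_succ']
    simp
  have hstep : (M.stepKernel σ π n x) {s'} = ENNReal.ofReal (M.stepProb σ π ⟨n, f⟩ s') := by
    classical
    change (M.stepMeasure σ π ⟨n, f⟩) {s'} = _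
    simp [stepMeasure, Measure.coe_finsetSum, Finset.sum_apply, Set.indicator_apply]
  have hmx : MeasurableSet ({x} : Set ((_ : Finset.Iic n) → S)) := MeasurableSet.of_discrete
  have hms : MeasurableSet ({s'} : Set S) := MeasurableSet.of_discrete
  have key : M.pathMeasure s σ π (FinPath.snoc ⟨n, f⟩ s').cylinder =
      M.pathMeasure s σ π (FinPath.cylinder ⟨n, f⟩) *
        ENNReal.ofReal (M.stepProb σ π ⟨n, f⟩ s') := by
    rw [hset, hset0, ← Measure.map_apply (by fun_prop) (hmx.prod hms),
      ← Measure.map_apply (by fun_prop) hmx, pathMeasure, ← h, h0,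
      Measure.compProd_apply_prod hmx hms, lintegral_singleton, hstep, mul_comm]
  rw [Measure.real, key, ENNReal.toReal_mul, ENNReal.toReal_ofReal (M.stepProb_nonneg σ π _ _)]
  rfl

/-- Satisfaction of PCTL formulas when the probabilistic operator is read as "there is a scheduler
such that for all natures". An infinite path is written `w 0, w 1, w 2, …`, with `w 0` its
initial state. -/
def Sat (M : IMDP S A AP) : {κ : FormulaKind} → PCTL AP κ → κ.Domain S → Prop
  | _, .tt => fun _ => True
  | _, .atom x => fun s => x ∈ M.label s
  | _, .neg φ => fun s => ¬ M.Sat φ s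
  | _, .and φ₁ φ₂ => fun s => M.Sat φ₁ s ∧ M.Sat φ₂ s
  | _, .prob r p ψ => fun s => ∃ σ : M.Scheduler, ∀ π : M.Nature,
      r.Rel ((M.pathMeasure s σ π).real {w : ℕ → S | M.Sat ψ w}) ((p : ℚ) : ℝ)
  | _, .next φ => fun w => M.Sat φ (w 1)
  | _, .til φ₁ φ₂ => fun w => ∃ k : ℕ, ∃ i ≤ k, M.Sat φ₂ (w i) ∧ ∀ j < i, M.Sat φ₁ (w j)
  | _, .boundedTil k φ₁ φ₂ => fun w => ∃ i ≤ k, M.Sat φ₂ (w i) ∧ ∀ j < i, M.Sat φ₁ (w j)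

end Measure

/-- `s →_ρ μ`: the successor distributions that are possible from `s` when the scheduler decides for
`ρ` and nature chooses a feasible distribution for each action. -/
def Transition (M : IMDP S A AP) (s : S) (ρ : stdSimplex ℝ A) (μ : S → ℝ) : Prop :=
  ∃ m : A → S → ℝ, (∀ a, m a ∈ M.feasible s a) ∧ ∀ s', μ s' = ∑ a, ρ.1 a * m a s'

/-- The probability `μ(C)` of a set `C` of states under a distribution `μ`. -/
noncomputable def mass (μ : S → ℝ) (C : Set S) : ℝ := ∑ s, C.indicator μ s

/-- Probabilistic (∃σ∀)-bisimulations; a `Setoid` is an equivalence relation. -/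
def IsBisimulation (M : IMDP S A AP) (R : Setoid S) : Prop :=
  ∀ s t, R s t → M.label s = M.label t ∧
    ∀ ρs : stdSimplex ℝ A, ∃ ρt : stdSimplex ℝ A,
      ∀ ν, M.Transition t ρt ν → ∃ μ, M.Transition s ρs μ ∧ ∀ C ∈ R.classes, mass μ C = mass ν C

/-- `s ∼ t` for the competitive (∃σ∀)-bisimulation. -/
def Bisimilar (M : IMDP S A AP) (s t : S) : Prop :=
  ∃ R : Setoid S, M.IsBisimulation R ∧ R s t

end IMDP

/-! Fix a bisimulation `R` and use structural induction on formulas; only the probabilistic operator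
needs work. There the scheduler and nature play a game whose payoff is the probability of the path
formula, and `R`-related states must give the scheduler the same guarantees. A single step transfers
only classwise, that is, for expectations of `R`-invariant functions.

Next and bounded until are games with finite horizon, and a scheduler is transferred by induction on
the horizon (`IsBisimulation.exists_val_le`). Since schedulers depend on the history, the given one
may behave differently after related successors. The copy imitates the continuation that leaves
nature least room; it exists because lower sets of reals are totally ordered
(`exists_least_payoffs`).

For unbounded until, the optimal values `V` (scheduler minimises) and `W` (scheduler maximises) are
limits of value iteration, hence `R`-invariant. The scheduler attains both: `V` by locally optimal
decisions, `W` by a discounting argument (`exists_scheduler_le_limVal`). Nature approximates both.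
This settles every comparison except a strict one whose threshold is the value itself.

That case is delicate because feasible sets need not be closed, so nature may fail to attain the
value. The question is where the scheduler does strictly better than the value against every nature,
and a maximal trap (`IsTrap`) is the answer. Inside it, a nature that gives nothing away is driven
to lower and lower rank with positive probability or, if it maximises, may also be kept in the trap
forever with payoff zero. Outside it, nature attains the value (`exists_nature_le_limVal_of_notMem`,
`exists_nature_limVal_le_of_notMem`). Saturating a trap under `R` yields a trap, so a maximal one is
`R`-invariant. -/

open scoped Matrix

/-! ### Prefixes of finite paths and the splicing of strategies. -/

namespace FinPath

variable {S : Type*}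

@[simp]
lemma last_snoc (ω : FinPath S) (s : S) : (ω.snoc s).last = s := by
  simp [last, snoc]

lemma cylinder_snoc (ω : FinPath S) (s : S) :
    (ω.snoc s).cylinder = ω.cylinder ∩ (fun w => w (ω.1 + 1)) ⁻¹' {s} := by
  ext w
  change (∀ i : Fin (ω.1 + 1 + 1), w i = Fin.snoc (α := fun _ => S) ω.2 s i) ↔ _
  rw [Fin.forall_fin_succ']
  simp [cylinder]

/-- `ω.Extends τ` means that `ω` is a prefix of `τ`. -/
inductive Extends (ω : FinPath S) : FinPath S → Prop
  | refl : Extends ω ω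
  | snoc {τ : FinPath S} (s : S) (h : Extends ω τ) : Extends ω (τ.snoc s)

lemma Extends.of_snoc {ω τ : FinPath S} {s : S} (h : (ω.snoc s).Extends τ) : ω.Extends τ := by
  induction h with
  | refl => exact .snoc s .refl
  | snoc s _ ih => exact .snoc s ih

lemma Extends.exists_eq {ω τ : FinPath S} (h : ω.Extends τ) :
    ∃ hl : ω.1 ≤ τ.1, τ.2 ⟨ω.1, Nat.lt_succ_of_le hl⟩ = ω.last := by
  induction h with
  | refl => exact ⟨le_rfl, rfl⟩
  | @snoc τ s _ ih =>
    obtain ⟨hl, he⟩ := ih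
    refine ⟨hl.trans (Nat.le_succ _), ?_⟩
    rw [← he]
    have := Fin.snoc_castSucc (α := fun _ => S) s τ.2 ⟨ω.1, Nat.lt_succ_of_le hl⟩
    exact this

/-- Choices along finite paths may depend on the successor with which a path leaves `ω`. -/
lemma exists_branch {β : FinPath S → Type*} (ω : FinPath S) (m : β ω) (f : S → ∀ τ, β τ) :
    ∃ p : ∀ τ, β τ, p ω = m ∧ ∀ s τ, (ω.snoc s).Extends τ → p τ = f s τ := by
  classical
  -- The successor taken after `ω` is read off at index `ω.1 + 1`. On shorter paths only the value
  -- at `ω` matters, and `f ω.last` is a filler.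
  refine ⟨fun τ => if h : ω.1 + 1 ≤ τ.1 then f (τ.2 ⟨ω.1 + 1, Nat.lt_succ_of_le h⟩) τ
    else Function.update (f ω.last) ω m τ, by simp, ?_⟩
  intro s τ h
  obtain ⟨hl, he⟩ := h.exists_eq
  have hl' : ω.1 + 1 ≤ τ.1 := hl
  have he' : τ.2 ⟨ω.1 + 1, Nat.lt_succ_of_le hl'⟩ = s := by
    rw [last_snoc] at he
    exact he
  simp only [hl', dite_true, he']

/-- Recursion along the prefixes of a finite path. -/
def prefixRec {β : Type*} (b : FinPath S → β) (st : FinPath S → β → β) :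
    (n : ℕ) → (Fin (n + 1) → S) → β
  | 0, f => b ⟨0, f⟩
  | n + 1, f => st ⟨n + 1, f⟩ (prefixRec b st n (Fin.init (α := fun _ => S) f))

lemma exists_prefixRec {β : Type*} (b : FinPath S → β) (st : FinPath S → β → β) :
    ∃ F : FinPath S → β, (∀ f, F ⟨0, f⟩ = b ⟨0, f⟩) ∧
      ∀ τ s, F (τ.snoc s) = st (τ.snoc s) (F τ) := by
  refine ⟨fun τ => prefixRec b st τ.1 τ.2, fun f => rfl, fun τ s => ?_⟩
  change st _ (prefixRec b st τ.1 (Fin.init (α := fun _ => S) (Fin.snoc (α := fun _ => S) τ.2 s))) = _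
  rw [Fin.init_snoc]
  rfl

/-- Follow `p₀` until the first time that `K` holds, and switch to `p τ` at that path `τ`. -/
lemma exists_stitch {β : FinPath S → Type*} (K : FinPath S → Prop) (p₀ : ∀ τ, β τ)
    (p : FinPath S → ∀ τ, β τ) :
    ∃ (q : ∀ τ, β τ) (live : FinPath S → Prop), (∀ f, live ⟨0, f⟩) ∧
      (∀ τ, live τ → ¬ K τ → q τ = p₀ τ ∧ ∀ s, live (τ.snoc s)) ∧
      ∀ τ, live τ → K τ → ∀ τ', τ.Extends τ' → q τ' = p τ τ' := by
  classical
  -- `F τ` records the first prefix of `τ` satisfying `K`, and `live τ` will say that no proper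
  -- prefix of `τ` does.
  obtain ⟨F, hF0, hF⟩ := exists_prefixRec (S := S) (β := Option (FinPath S))
    (fun τ => if K τ then some τ else none)
    (fun τ o => match o with
      | some x => some x
      | none => if K τ then some τ else none)
  refine ⟨fun τ => match F τ with
      | some x => p x τ
      | none => p₀ τ, fun τ => F τ = if K τ then some τ else none, hF0, ?_, ?_⟩
  · intro τ hτ hK
    rw [if_neg hK] at hτ
    refine ⟨by simp [hτ], fun s => (hF τ s).trans (by rw [hτ])⟩
  · intro τ hτ hK τ' h
    rw [if_pos hK] at hτ
    have : F τ' = some τ := by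
      induction h with
      | refl => exact hτ
      | snoc s _ ih => rw [hF, ih]
    simp [this]

end FinPath

/-! ### Finite-horizon payoffs and their link to path probabilities. -/

namespace IMDP

variable {S A AP : Type*} [Fintype S] [Fintype A] {M : IMDP S A AP}

/-- The expected payoff after `ω` of the game with horizon `k` in which the play stops at a state
`s` with payoff `r` if `g j s = some r`, where `j` is the remaining horizon. -/
noncomputable def val (g : ℕ → S → Option ℝ) (σ : M.Scheduler) (π : M.Nature) :
    ℕ → FinPath S → ℝ
  | 0, ω => (g 0 ω.last).getD 0
  | k + 1, ω => (g (k + 1) ω.last).elim (M.stepProb σ π ω ⬝ᵥ fun s => val g σ π k (ω.snoc s)) id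

lemma val_congr {g : ℕ → S → Option ℝ} {σ σ' : M.Scheduler} {π π' : M.Nature} (k : ℕ)
    (ω : FinPath S) (hσ : ∀ τ, ω.Extends τ → σ τ = σ' τ) (hπ : ∀ τ, ω.Extends τ → π τ = π' τ) :
    val g σ π k ω = val g σ' π' k ω := by
  induction k generalizing ω with
  | zero => rfl
  | succ k ih =>
    have h1 : M.stepProb σ π ω = M.stepProb σ' π' ω := by
      funext s
      simp only [stepProb, hσ ω .refl, hπ ω .refl]
    have h2 : (fun s => val g σ π k (ω.snoc s)) = fun s => val g σ' π' k (ω.snoc s) := by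
      funext s
      exact ih _ (fun τ h => hσ τ h.of_snoc) (fun τ h => hπ τ h.of_snoc)
    simp only [val, h1, h2]

lemma val_neg (g : ℕ → S → Option ℝ) (σ : M.Scheduler) (π : M.Nature) (k : ℕ) (ω : FinPath S) :
    val (fun j s => (g j s).map Neg.neg) σ π k ω = - val g σ π k ω := by
  induction k generalizing ω with
  | zero => cases h : g 0 ω.last <;> simp [val, h]
  | succ k ih =>
    cases h : g (k + 1) ω.last with
    | none =>
      simp only [val, h, Option.map_none, Option.elim_none, ih, dotProduct, mul_neg,
        Finset.sum_neg_distrib]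
    | some r => simp [val, h]

lemma dotProduct_mono {μ : S → ℝ} (hμ : ∀ s, 0 ≤ μ s) {u v : S → ℝ}
    (h : ∀ s, 0 < μ s → u s ≤ v s) : μ ⬝ᵥ u ≤ μ ⬝ᵥ v := by
  refine Finset.sum_le_sum fun s _ => ?_
  rcases (hμ s).eq_or_lt with h0 | h0
  · simp [← h0]
  · exact mul_le_mul_of_nonneg_left (h s h0) h0.le

lemma dotProduct_strictMono {μ : S → ℝ} (hμ : ∀ s, 0 ≤ μ s) {u v : S → ℝ}
    (h : ∀ s, 0 < μ s → u s ≤ v s) (h' : ∃ s, 0 < μ s ∧ u s < v s) : μ ⬝ᵥ u < μ ⬝ᵥ v := by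
  obtain ⟨x, hx, hlt⟩ := h'
  refine Finset.sum_lt_sum (fun s _ => ?_) ⟨x, Finset.mem_univ _, mul_lt_mul_of_pos_left hlt hx⟩
  rcases (hμ s).eq_or_lt with h0 | h0
  · simp [← h0]
  · exact mul_le_mul_of_nonneg_left (h s h0) h0.le

lemma dotProduct_const {μ : S → ℝ} (hμ : μ ∈ stdSimplex ℝ S) (c : ℝ) :
    (μ ⬝ᵥ fun _ => c) = c := by
  rw [dotProduct, ← Finset.sum_mul, hμ.2, one_mul]

lemma dotProduct_add_const {μ : S → ℝ} (hμ : μ ∈ stdSimplex ℝ S) (u : S → ℝ) (c : ℝ) :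
    (μ ⬝ᵥ fun s => u s + c) = μ ⬝ᵥ u + c := by
  have : (fun s => u s + c) = u + fun _ => c := rfl
  rw [this, dotProduct_add, dotProduct_const hμ]

lemma stepProb_mem (σ : M.Scheduler) (π : M.Nature) (ω : FinPath S) :
    M.stepProb σ π ω ∈ stdSimplex ℝ S :=
  ⟨M.stepProb_nonneg σ π ω, M.sum_stepProb σ π ω⟩

lemma transition_stepProb (σ : M.Scheduler) (π : M.Nature) (ω : FinPath S) :
    M.Transition ω.last (σ ω) (M.stepProb σ π ω) :=
  ⟨fun a => (π ω a).1, fun a => (π ω a).2, fun _ => rfl⟩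

lemma Transition.mem {s : S} {ρ : stdSimplex ℝ A} {μ : S → ℝ} (h : M.Transition s ρ μ) :
    μ ∈ stdSimplex ℝ S := by
  obtain ⟨m, hm, hμ⟩ := h
  refine ⟨fun x => ?_, ?_⟩
  · rw [hμ]
    exact Finset.sum_nonneg fun a _ => mul_nonneg (ρ.2.1 a) ((hm a).1.1 x)
  · simp_rw [hμ]
    rw [Finset.sum_comm]
    simp_rw [← Finset.mul_sum, (hm _).1.2, mul_one]
    exact ρ.2.2

lemma sum_mul_dotProduct (ρ : A → ℝ) (m : A → S → ℝ) (u : S → ℝ) :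
    (fun s => ∑ a, ρ a * m a s) ⬝ᵥ u = ∑ a, ρ a * (m a ⬝ᵥ u) := by
  simp only [dotProduct, Finset.sum_mul, Finset.mul_sum]
  rw [Finset.sum_comm]
  simp only [mul_assoc]

/-- Nature can realise a given transition at `ω` and continue with `f s` after the successor `s`. -/
lemma exists_nature_branch {σ : M.Scheduler} {ω : FinPath S} {μ : S → ℝ}
    (hμ : M.Transition ω.last (σ ω) μ) (f : S → M.Nature) :
    ∃ π : M.Nature, M.stepProb σ π ω = μ ∧
      ∀ g k s, val g σ π k (ω.snoc s) = val g σ (f s) k (ω.snoc s) := by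
  obtain ⟨m, hm, hμ⟩ := hμ
  obtain ⟨π, h1, h2⟩ := FinPath.exists_branch (β := fun τ => ∀ a, M.feasible τ.last a) ω
    (fun a => ⟨m a, hm a⟩) f
  refine ⟨π, ?_, fun g k s => val_congr _ _ (fun _ _ => rfl) (h2 s)⟩
  funext s
  rw [hμ]
  simp only [stepProb, h1]

/-- A scheduler can decide for `ρ` at `ω` and continue with `f s` after the successor `s`. -/
lemma exists_scheduler_branch (ω : FinPath S) (ρ : stdSimplex ℝ A) (f : S → M.Scheduler) :
    ∃ σ : M.Scheduler, σ ω = ρ ∧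
      ∀ g π k s, val g σ π k (ω.snoc s) = val g (f s) π k (ω.snoc s) := by
  obtain ⟨σ, h1, h2⟩ := FinPath.exists_branch (β := fun _ => stdSimplex ℝ A) ω ρ f
  exact ⟨σ, h1, fun g π k s => val_congr _ _ (h2 s) (fun _ _ => rfl)⟩

section Measure

variable [MeasurableSpace S] [DiscreteMeasurableSpace S]

lemma real_inter_eq_sum (P : Measure (ℕ → S)) [IsFiniteMeasure P] (ω : FinPath S)
    (E : Set (ℕ → S)) :
    P.real (ω.cylinder ∩ E) = ∑ s, P.real ((ω.snoc s).cylinder ∩ E) := by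
  have hm : ∀ s : S, MeasurableSet ((fun w : ℕ → S => w (ω.1 + 1)) ⁻¹' {s}) := fun s =>
    measurable_pi_apply _ (MeasurableSet.of_discrete)
  have h := sum_measureReal_preimage_singleton (μ := P.restrict (ω.cylinder ∩ E))
    (f := fun w : ℕ → S => w (ω.1 + 1)) Finset.univ (fun s _ => hm s)
  simp only [Finset.coe_univ, Set.preimage_univ, measureReal_restrict_apply, hm,
    MeasurableSet.univ, Set.univ_inter] at h
  rw [← h]
  refine Finset.sum_congr rfl fun s _ => ?_
  rw [FinPath.cylinder_snoc]
  congr 1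
  ext w
  simp only [Set.mem_inter_iff]
  tauto

open Classical in
/-- If the events `E k n` (horizon `k`, starting at time `n`) are described by the stopping rule
`g`, then their conditional probabilities are given by `val g`. -/
lemma pathMeasure_inter_eq_val (s : S) (σ : M.Scheduler) (π : M.Nature) (g : ℕ → S → Option ℝ)
    (E : ℕ → ℕ → Set (ℕ → S))
    (h0 : ∀ n w, (g 0 (w n)).getD 0 = if w ∈ E 0 n then 1 else 0)
    (hs : ∀ k n w r, g (k + 1) (w n) = some r → r = if w ∈ E (k + 1) n then 1 else 0)
    (hn : ∀ k n w, g (k + 1) (w n) = none → (w ∈ E (k + 1) n ↔ w ∈ E k (n + 1)))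
    (k : ℕ) (ω : FinPath S) :
    (M.pathMeasure s σ π).real (ω.cylinder ∩ E k ω.1) =
      (M.pathMeasure s σ π).real ω.cylinder * val g σ π k ω := by
  have hlast : ∀ ω : FinPath S, ∀ w ∈ ω.cylinder, w ω.1 = ω.last := fun ω w hw => hw (Fin.last ω.1)
  have const : ∀ (ω : FinPath S) (k : ℕ) (r : ℝ),
      (∀ w ∈ ω.cylinder, r = if w ∈ E k ω.1 then 1 else 0) →
      (M.pathMeasure s σ π).real (ω.cylinder ∩ E k ω.1) =
        (M.pathMeasure s σ π).real ω.cylinder * r := by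
    intro ω k r hr
    by_cases h : ω.cylinder ⊆ E k ω.1
    · rw [Set.inter_eq_left.2 h]
      rcases ω.cylinder.eq_empty_or_nonempty with he | ⟨w, hw⟩
      · simp [he]
      · rw [hr w hw, if_pos (h hw), mul_one]
    · obtain ⟨w, hw, hE⟩ := Set.not_subset.1 h
      have hr0 : r = 0 := by rw [hr w hw, if_neg hE]
      have : ω.cylinder ∩ E k ω.1 = ∅ := by
        ext w'
        simp only [Set.mem_inter_iff, Set.mem_empty_iff_false, iff_false, not_and]
        intro hw' hE'
        have := hr w' hw'
        rw [if_pos hE', hr0] at this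
        exact zero_ne_one this
      simp [this, hr0]
  induction k generalizing ω with
  | zero =>
    refine const ω 0 _ fun w hw => ?_
    rw [← h0, hlast ω w hw]
    rfl
  | succ k ih =>
    cases hg : g (k + 1) ω.last with
    | some r =>
      simp only [val, hg, Option.elim_some, id]
      exact const ω _ _ fun w hw => hs _ _ _ _ (by rw [hlast ω w hw, hg])
    | none =>
      have hE : ω.cylinder ∩ E (k + 1) ω.1 = ω.cylinder ∩ E k (ω.1 + 1) := by
        ext w
        exact and_congr_right fun hw => hn _ _ _ (by rw [hlast ω w hw, hg])
      simp only [val, hg, Option.elim_none]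
      rw [hE, real_inter_eq_sum, dotProduct, Finset.mul_sum]
      refine Finset.sum_congr rfl fun x _ => ?_
      have := ih (ω.snoc x)
      rw [pathMeasure_cylinder_snoc, mul_assoc] at this
      exact this

/-- The cylinder of the initial state has full measure, so the conditional probability given this
cylinder is the probability itself. -/
lemma pathMeasure_real_eq_val (s : S) (σ : M.Scheduler) (π : M.Nature) (g : ℕ → S → Option ℝ)
    (E : ℕ → ℕ → Set (ℕ → S))
    (h0 : ∀ n w, (w ∈ E 0 n → (g 0 (w n)).getD 0 = 1) ∧ (w ∉ E 0 n → (g 0 (w n)).getD 0 = 0))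
    (hs : ∀ k n w r, g (k + 1) (w n) = some r → (w ∈ E (k + 1) n → r = 1) ∧ (w ∉ E (k + 1) n → r = 0))
    (hn : ∀ k n w, g (k + 1) (w n) = none → (w ∈ E (k + 1) n ↔ w ∈ E k (n + 1)))
    (k : ℕ) :
    (M.pathMeasure s σ π).real (E k 0) = val g σ π k ⟨0, fun _ => s⟩ := by
  classical
  have key := pathMeasure_inter_eq_val (M := M) s σ π g E
    (fun n w => by
      split_ifs with h
      exacts [(h0 n w).1 h, (h0 n w).2 h])
    (fun k n w r hr => by
      split_ifs with h
      exacts [(hs k n w r hr).1 h, (hs k n w r hr).2 h]) hn k ⟨0, fun _ => s⟩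
  have h1 : (M.pathMeasure s σ π).real (FinPath.cylinder ⟨0, fun _ => s⟩) = 1 := by
    rw [pathMeasure_cylinder_zero]
    simp
  rw [h1, one_mul] at key
  rw [← key]
  refine measureReal_congr ?_
  have h2 : ∀ᵐ w ∂(M.pathMeasure s σ π), w ∈ FinPath.cylinder ⟨0, fun _ => s⟩ := by
    rw [ae_iff]
    have h3 := prob_compl_eq_zero_iff (μ := M.pathMeasure s σ π)
      (s := FinPath.cylinder ⟨0, fun _ => s⟩) (by
        have : FinPath.cylinder ⟨0, fun _ => s⟩ = (fun w : ℕ → S => w 0) ⁻¹' {s} := by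
          ext w
          simp [FinPath.cylinder]
        rw [this]
        exact measurable_pi_apply _ MeasurableSet.of_discrete)
    refine h3.2 ?_
    rwa [measureReal_def, ENNReal.toReal_eq_one_iff] at h1
  filter_upwards [h2] with w hw
  exact propext ⟨fun h => ⟨hw, h⟩, fun h => h.2⟩

end Measure

end IMDP

/-! ### Transfer of schedulers for finite horizons. -/

namespace IMDP

variable {S A AP : Type*} [Fintype S] [Fintype A] {M : IMDP S A AP} {R : Setoid S}

/-- The expectation of an invariant function is the sum over the classes of the mass times the
common value. -/
lemma dotProduct_eq_of_mass_eq {μ ν u : S → ℝ} (h : ∀ C ∈ R.classes, mass μ C = mass ν C)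
    (hu : ∀ x y, R x y → u x = u y) : μ ⬝ᵥ u = ν ⬝ᵥ u := by
  classical
  have key : ∀ (μ : S → ℝ) (y : S),
      ∑ s with (Quotient.mk R s = Quotient.mk R y), μ s * u s = mass μ {x | R x y} * u y := by
    intro μ y
    rw [mass, Finset.sum_mul, Finset.sum_filter]
    refine Finset.sum_congr rfl fun s _ => ?_
    by_cases hs : R s y
    · rw [if_pos (Quotient.sound hs), Set.indicator_of_mem (show s ∈ {x | R x y} from hs),
        hu s y hs]
    · rw [if_neg fun h => hs (Quotient.exact h),
        Set.indicator_of_notMem (show s ∉ {x | R x y} from hs), zero_mul]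
  have key' : ∀ μ : S → ℝ, μ ⬝ᵥ u =
      ∑ q : Quotient R, ∑ s with (Quotient.mk R s = q), μ s * u s := fun μ =>
    (Finset.sum_fiberwise _ _ _).symm
  rw [key', key']
  refine Finset.sum_congr rfl fun q _ => ?_
  obtain ⟨y, rfl⟩ := Quotient.exists_rep q
  have e := key μ y
  have e' := key ν y
  rw [h _ (R.mem_classes y), ← e'] at e
  exact e

lemma IsBisimulation.exists_match (hR : M.IsBisimulation R) {s t : S} (hst : R s t)
    (ρs : stdSimplex ℝ A) : ∃ ρt : stdSimplex ℝ A, ∀ ν, M.Transition t ρt ν →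
      ∃ μ, M.Transition s ρs μ ∧ ∀ u : S → ℝ, (∀ x y, R x y → u x = u y) → μ ⬝ᵥ u = ν ⬝ᵥ u := by
  obtain ⟨ρt, h⟩ := (hR s t hst).2 ρs
  refine ⟨ρt, fun ν hν => ?_⟩
  obtain ⟨μ, hμ, hC⟩ := h ν hν
  exact ⟨μ, hμ, fun u hu => dotProduct_eq_of_mass_eq hC hu⟩

/-- Test the equality on the indicator of the class of `x`. -/
lemma exists_pos_of_dotProduct_eq {μ ν : S → ℝ} (hμ : ∀ x, 0 ≤ μ x) (hν : ∀ x, 0 ≤ ν x)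
    (h : ∀ u : S → ℝ, (∀ x y, R x y → u x = u y) → μ ⬝ᵥ u = ν ⬝ᵥ u) {x : S} (hx : 0 < ν x) :
    ∃ y, R x y ∧ 0 < μ y := by
  classical
  by_contra! hc
  have h1 := h (fun y => if R x y then 1 else 0) fun y z hyz => by
    have : R x y ↔ R x z := ⟨fun h => R.trans h hyz, fun h => R.trans h (R.symm hyz)⟩
    simp only [this]
  have h2 : (μ ⬝ᵥ fun y => if R x y then (1 : ℝ) else 0) = 0 := by
    refine Finset.sum_eq_zero fun y _ => ?_
    by_cases hy : R x y
    · simp [le_antisymm (hc y hy) (hμ y)]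
    · simp [hy]
  have h3 : ν x ≤ ν ⬝ᵥ fun y => if R x y then (1 : ℝ) else 0 := by
    have := Finset.single_le_sum (f := fun y => ν y * if R x y then (1 : ℝ) else 0)
      (fun y _ => mul_nonneg (hν y) (by split_ifs <;> norm_num)) (Finset.mem_univ x)
    simpa [dotProduct, R.refl x] using this
  linarith

/-- In a finite nonempty set of games there is one whose payoffs are dominated by those of every
other one. -/
lemma exists_least_payoffs {ι κ : Type*} {s : Set ι} (hs : s.Finite) (hne : s.Nonempty)
    (F : ι → κ → ℝ) : ∃ i ∈ s, ∀ j ∈ s, ∀ x, ∃ y, F i x ≤ F j y := by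
  obtain ⟨i, hi⟩ := hs.exists_minimalFor (fun i => lowerClosure (Set.range (F i))) s hne
  refine ⟨i, hi.1, fun j hj x => ?_⟩
  -- Lower sets of a linear order are comparable, so a minimal lower closure is a least one.
  have hle : lowerClosure (Set.range (F i)) ≤ lowerClosure (Set.range (F j)) := by
    rcases LowerSet.total_le.total (lowerClosure (Set.range (F i)))
      (lowerClosure (Set.range (F j))) with h | h
    · exact h
    · exact hi.2 hj h
  obtain ⟨_, ⟨y, rfl⟩, hy⟩ := hle (subset_lowerClosure ⟨x, rfl⟩)
  exact ⟨y, hy⟩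

/-- Simulation for finite horizons. -/
lemma IsBisimulation.exists_val_le (hR : M.IsBisimulation R) {g : ℕ → S → Option ℝ}
    (hg : ∀ k x y, R x y → g k x = g k y) (k : ℕ) {ω ω' : FinPath S} (h : R ω.last ω'.last)
    (σ : M.Scheduler) : ∃ σ' : M.Scheduler, ∀ π' : M.Nature, ∃ π : M.Nature,
      val g σ' π' k ω' ≤ val g σ π k ω := by
  induction k generalizing ω ω' σ with
  | zero => exact ⟨σ, fun π' => ⟨π', by simp only [val, hg 0 _ _ h, le_refl]⟩⟩
  | succ k ih =>
    cases hgs : g (k + 1) ω.last with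
    | some r =>
      have hgt := (hg (k + 1) _ _ h).symm.trans hgs
      exact ⟨σ, fun π' => ⟨π', by simp [val, hgs, hgt]⟩⟩
    | none =>
      have hgt := (hg (k + 1) _ _ h).symm.trans hgs
      obtain ⟨ρ, hρ⟩ := hR.exists_match h (σ ω)
      -- The successor distributions agree only on classes, so the continuation after `y` has to
      -- work against every related `x` at once. Imitating `σ` after the `x` with the least payoffs
      -- achieves this.
      have best : ∀ y, ∃ σ' : M.Scheduler, ∀ x, R x y → ∀ π' : M.Nature, ∃ π : M.Nature,
          val g σ' π' k (ω'.snoc y) ≤ val g σ π k (ω.snoc x) := by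
        intro y
        obtain ⟨z, hz, hmin⟩ := exists_least_payoffs (s := {x | R x y}) (Set.toFinite _)
          ⟨y, R.refl y⟩ (fun x (π : M.Nature) => val g σ π k (ω.snoc x))
        obtain ⟨σ', hσ'⟩ := @ih (ω.snoc z) (ω'.snoc y) (by simpa using hz) σ
        refine ⟨σ', fun x hx π' => ?_⟩
        obtain ⟨π₁, h₁⟩ := hσ' π'
        obtain ⟨π₂, h₂⟩ := hmin x hx π₁
        exact ⟨π₂, h₁.trans h₂⟩
      choose f hf using best
      obtain ⟨σ', hσ'ω, hσ'⟩ := exists_scheduler_branch ω' ρ f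
      refine ⟨σ', fun π' => ?_⟩
      obtain ⟨μ, hμ, hu⟩ := hρ (M.stepProb σ' π' ω') (hσ'ω ▸ transition_stepProb σ' π' ω')
      let v : S → ℝ := fun y => val g σ' π' k (ω'.snoc y)
      -- Replacing `v` by its maximum over the class gives an invariant function, whose expectation
      -- can be moved from the matched step to `μ`. The maximum is attained because classes are
      -- finite.
      let c : S → ℝ := fun x => sSup (v '' {y | R x y})
      have hfin : ∀ x, (v '' {y | R x y}).Finite := fun x => Set.toFinite _
      have hc : ∀ x y, R x y → c x = c y := by
        intro x y hxy
        have : {z | R x z} = {z | R y z} := by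
          ext z
          exact ⟨fun h => R.trans (R.symm hxy) h, fun h => R.trans hxy h⟩
        simp only [c, this]
      have hπ : ∀ x, ∃ π : M.Nature, c x ≤ val g σ π k (ω.snoc x) := by
        intro x
        obtain ⟨y, hy, hyc⟩ := Set.Nonempty.csSup_mem (s := v '' {y | R x y})
          ⟨v x, x, R.refl x, rfl⟩ (hfin x)
        obtain ⟨π, hπ⟩ := hf y x hy π'
        refine ⟨π, ?_⟩
        rw [← hσ' g π' k y] at hπ
        exact hyc.symm.trans_le hπ
      choose fπ hfπ using hπ
      obtain ⟨π, hπω, hπ⟩ := exists_nature_branch hμ fπ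
      refine ⟨π, ?_⟩
      simp only [val, hgs, hgt, Option.elim_none, hπω]
      calc M.stepProb σ' π' ω' ⬝ᵥ v ≤ M.stepProb σ' π' ω' ⬝ᵥ c :=
            dotProduct_mono (M.stepProb_nonneg σ' π' ω') fun y _ =>
              le_csSup (hfin y).bddAbove ⟨y, R.refl y, rfl⟩
        _ = μ ⬝ᵥ c := (hu c hc).symm
        _ ≤ μ ⬝ᵥ fun x => val g σ π k (ω.snoc x) :=
            dotProduct_mono hμ.mem.1 fun x _ => by
              rw [hπ]
              exact hfπ x

/-- Payoffs are arbitrary reals, so negating them turns this into the opposite inequality. -/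
lemma IsBisimulation.exists_le_val (hR : M.IsBisimulation R) {g : ℕ → S → Option ℝ}
    (hg : ∀ k x y, R x y → g k x = g k y) (k : ℕ) {ω ω' : FinPath S} (h : R ω.last ω'.last)
    (σ : M.Scheduler) : ∃ σ' : M.Scheduler, ∀ π' : M.Nature, ∃ π : M.Nature,
      val g σ π k ω ≤ val g σ' π' k ω' := by
  obtain ⟨σ', h'⟩ := hR.exists_val_le (g := fun j s => (g j s).map Neg.neg)
    (fun k x y hxy => by rw [hg k x y hxy]) k h σ
  refine ⟨σ', fun π' => ?_⟩
  obtain ⟨π, hπ⟩ := h' π'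
  rw [val_neg, val_neg, neg_le_neg_iff] at hπ
  exact ⟨π, hπ⟩

/-- Bisimilar states satisfy the same probabilistic properties with a finite horizon. -/
lemma IsBisimulation.finite_horizon (hR : M.IsBisimulation R) {g : ℕ → S → Option ℝ}
    (hg : ∀ k x y, R x y → g k x = g k y) (k : ℕ) {s t : S} (h : R s t) (r : Comparison) (p : ℝ)
    (hs : ∃ σ : M.Scheduler, ∀ π : M.Nature, r.Rel (val g σ π k ⟨0, fun _ => s⟩) p) :
    ∃ σ : M.Scheduler, ∀ π : M.Nature, r.Rel (val g σ π k ⟨0, fun _ => t⟩) p := by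
  obtain ⟨σ, hσ⟩ := hs
  obtain ⟨σ₁, h₁⟩ := hR.exists_val_le hg k
    (ω := ⟨0, fun _ => s⟩) (ω' := ⟨0, fun _ => t⟩) h σ
  obtain ⟨σ₂, h₂⟩ := hR.exists_le_val hg k
    (ω := ⟨0, fun _ => s⟩) (ω' := ⟨0, fun _ => t⟩) h σ
  cases r with
  | le => exact ⟨σ₁, fun π' => let ⟨π, hπ⟩ := h₁ π'; hπ.trans (hσ π)⟩
  | lt => exact ⟨σ₁, fun π' => let ⟨π, hπ⟩ := h₁ π'; hπ.trans_lt (hσ π)⟩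
  | ge => exact ⟨σ₂, fun π' => let ⟨π, hπ⟩ := h₂ π'; (show p ≤ _ from hσ π).trans hπ⟩
  | gt => exact ⟨σ₂, fun π' => let ⟨π, hπ⟩ := h₂ π'; (show p < _ from hσ π).trans_le hπ⟩

end IMDP

namespace IMDP

set_option linter.unusedSectionVars false

open Filter Topology

variable {S A AP : Type*} [Fintype S] [Fintype A] {M : IMDP S A AP} {R : Setoid S}

/-! ### The one-step game. -/

section MinMax

/-- The optimal expected value of `u` after one step, when the scheduler minimises and nature
maximises. -/
noncomputable def minMax (M : IMDP S A AP) (u : S → ℝ) (x : S) : ℝ :=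
  ⨅ a, sSup ((fun μ => μ ⬝ᵥ u) '' M.feasible x a)

lemma bddAbove_feasible (x : S) (a : A) (u : S → ℝ) :
    BddAbove ((fun μ => μ ⬝ᵥ u) '' M.feasible x a) := by
  refine ⟨∑ y, |u y|, ?_⟩
  rintro _ ⟨μ, hμ, rfl⟩
  refine Finset.sum_le_sum fun y _ => ?_
  have h0 := hμ.1.1 y
  have h1 : μ y ≤ 1 := (Finset.single_le_sum (fun z _ => hμ.1.1 z) (Finset.mem_univ y)).trans_eq hμ.1.2
  calc μ y * u y ≤ μ y * |u y| := mul_le_mul_of_nonneg_left (le_abs_self _) h0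
    _ ≤ 1 * |u y| := mul_le_mul_of_nonneg_right h1 (abs_nonneg _)
    _ = |u y| := one_mul _

lemma feasible_nonempty' (x : S) (a : A) : (M.feasible x a).Nonempty := M.feasible_nonempty x a

instance : Nonempty M.Nature := ⟨fun τ a => ⟨_, (M.feasible_nonempty' τ.last a).choose_spec⟩⟩

variable [Nonempty A]

lemma minMax_le_iff {u : S → ℝ} {x : S} {c : ℝ} :
    M.minMax u x ≤ c ↔ ∃ a, ∀ μ ∈ M.feasible x a, μ ⬝ᵥ u ≤ c := by
  constructor
  · intro h
    obtain ⟨a, ha⟩ := exists_eq_ciInf_of_finite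
      (f := fun a => sSup ((fun μ => μ ⬝ᵥ u) '' M.feasible x a))
    refine ⟨a, fun μ hμ => (le_csSup (bddAbove_feasible x a u) ⟨μ, hμ, rfl⟩).trans ?_⟩
    exact (ha.trans_le h)
  · rintro ⟨a, ha⟩
    refine (ciInf_le (Set.finite_range _).bddBelow a).trans ?_
    refine csSup_le ((feasible_nonempty' x a).image _) ?_
    rintro _ ⟨μ, hμ, rfl⟩
    exact ha μ hμ

lemma lt_minMax_iff {u : S → ℝ} {x : S} {c : ℝ} :
    c < M.minMax u x ↔ ∀ a, ∃ μ ∈ M.feasible x a, c < μ ⬝ᵥ u := by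
  rw [← not_le, minMax_le_iff]
  push Not
  rfl

lemma minMax_mono : Monotone M.minMax := by
  intro u v h x
  obtain ⟨a, ha⟩ := minMax_le_iff.1 (le_refl (M.minMax v x))
  exact minMax_le_iff.2 ⟨a, fun μ hμ => (dotProduct_mono hμ.1.1 fun y _ => h y).trans (ha μ hμ)⟩

lemma minMax_le_of_forall_le {u : S → ℝ} {c : ℝ} (h : ∀ y, u y ≤ c) (x : S) : M.minMax u x ≤ c :=
  minMax_le_iff.2 ⟨Classical.arbitrary A, fun _ hμ =>
    (dotProduct_mono hμ.1.1 fun y _ => h y).trans_eq (dotProduct_const hμ.1 c)⟩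

lemma le_minMax_of_forall_le {u : S → ℝ} {c : ℝ} (h : ∀ y, c ≤ u y) (x : S) :
    c ≤ M.minMax u x := by
  obtain ⟨a, ha⟩ := minMax_le_iff.1 (le_refl (M.minMax u x))
  obtain ⟨μ, hμ⟩ := feasible_nonempty' (M := M) x a
  exact ((dotProduct_const hμ.1 c).symm.trans_le (dotProduct_mono hμ.1.1 fun y _ => h y)).trans
    (ha μ hμ)

omit [Nonempty A] in
lemma exists_dirac (x : S) (a : A) :
    ∃ ρ : stdSimplex ℝ A, ∀ μ, M.Transition x ρ μ → μ ∈ M.feasible x a := by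
  classical
  refine ⟨⟨Pi.single a 1, single_mem_stdSimplex ℝ a⟩, ?_⟩
  rintro μ ⟨m, hm, hμ⟩
  have : μ = m a := by
    funext y
    rw [hμ, Finset.sum_eq_single a]
    · simp
    · intro b _ hb
      simp [hb]
    · simp
  rw [this]
  exact hm a

-- A randomised decision averages over actions, so nature beats `c` by beating it for each action
-- separately. Hence randomising does not help the scheduler in one step, and `minMax` may range
-- over actions only.
omit [Nonempty A] in
lemma exists_transition_lt {u : S → ℝ} {x : S} {c : ℝ}
    (h : ∀ a, ∃ μ ∈ M.feasible x a, c < μ ⬝ᵥ u) (ρ : stdSimplex ℝ A) :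
    ∃ μ, M.Transition x ρ μ ∧ c < μ ⬝ᵥ u := by
  choose m hm hc using h
  refine ⟨_, ⟨m, hm, fun _ => rfl⟩, ?_⟩
  rw [sum_mul_dotProduct]
  obtain ⟨a, ha⟩ : ∃ a, 0 < ρ.1 a := by
    by_contra! h
    have := Finset.sum_nonpos fun a (_ : a ∈ Finset.univ) => h a
    rw [ρ.2.2] at this
    exact absurd this (by norm_num)
  calc c = ρ.1 ⬝ᵥ fun _ => c := (dotProduct_const ρ.2 c).symm
    _ < ρ.1 ⬝ᵥ fun a => m a ⬝ᵥ u := dotProduct_strictMono ρ.2.1 (fun a _ => (hc a).le) ⟨a, ha, hc a⟩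

/-- This expresses the one-step value through randomised decisions, which are what a bisimulation
matches. -/
lemma exists_scheduler_le_iff {u : S → ℝ} {x : S} {c : ℝ} :
    (∃ ρ, ∀ μ, M.Transition x ρ μ → μ ⬝ᵥ u ≤ c) ↔ M.minMax u x ≤ c := by
  constructor
  · rintro ⟨ρ, hρ⟩
    by_contra! h
    obtain ⟨μ, hμ, hlt⟩ := exists_transition_lt (lt_minMax_iff.1 h) ρ
    exact hlt.not_ge (hρ μ hμ)
  · intro h
    obtain ⟨a, ha⟩ := minMax_le_iff.1 h
    obtain ⟨ρ, hρ⟩ := exists_dirac (M := M) x a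
    exact ⟨ρ, fun μ hμ => ha μ (hρ μ hμ)⟩

lemma IsBisimulation.minMax_eq (hR : M.IsBisimulation R) {u : S → ℝ}
    (hu : ∀ x y, R x y → u x = u y) {x y : S} (h : R x y) : M.minMax u x = M.minMax u y := by
  have key : ∀ x y, R x y → M.minMax u y ≤ M.minMax u x := by
    intro x y h
    obtain ⟨ρ, hρ⟩ := exists_scheduler_le_iff.2 (le_refl (M.minMax u x))
    obtain ⟨ρ', hρ'⟩ := hR.exists_match h ρ
    refine exists_scheduler_le_iff.1 ⟨ρ', fun ν hν => ?_⟩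
    obtain ⟨μ, hμ, he⟩ := hρ' ν hν
    exact (he u hu).symm.trans_le (hρ μ hμ)
  exact le_antisymm (key _ _ (R.symm h)) (key _ _ h)

end MinMax

/-! ### Payoffs with infinite horizon. -/

section Reach

/-- The rule of the game that stops as soon as `D` is left, with payoff `e`. -/
noncomputable def stopRule (D : Set S) (e : S → ℝ) : ℕ → S → Option ℝ :=
  open Classical in fun _ s => if s ∈ D then none else some (e s)

/-- The expected payoff with infinite horizon. -/
noncomputable def limVal (D : Set S) (e : S → ℝ) (σ : M.Scheduler) (π : M.Nature)
    (ω : FinPath S) : ℝ :=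
  ⨆ k, val (stopRule D e) σ π k ω

variable {D : Set S} {e : S → ℝ} {σ : M.Scheduler} {π : M.Nature} {ω : FinPath S}

lemma val_stopRule_of_notMem (h : ω.last ∉ D) (k : ℕ) :
    val (stopRule D e) σ π k ω = e ω.last := by
  cases k <;> simp [val, stopRule, h]

lemma val_stopRule_zero (h : ω.last ∈ D) : val (stopRule D e) σ π 0 ω = 0 := by
  simp [val, stopRule, h]

lemma val_stopRule_succ (h : ω.last ∈ D) (k : ℕ) : val (stopRule D e) σ π (k + 1) ω =
    M.stepProb σ π ω ⬝ᵥ fun s => val (stopRule D e) σ π k (ω.snoc s) := by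
  simp [val, stopRule, h]

lemma val_stopRule_mem (he : ∀ s, e s ∈ Set.Icc (0 : ℝ) 1) (k : ℕ) (ω : FinPath S) :
    val (stopRule D e) σ π k ω ∈ Set.Icc (0 : ℝ) 1 := by
  induction k generalizing ω with
  | zero =>
    by_cases h : ω.last ∈ D
    · simp [val_stopRule_zero h]
    · rw [val_stopRule_of_notMem h]
      exact he _
  | succ k ih =>
    by_cases h : ω.last ∈ D
    · rw [val_stopRule_succ h]
      have hm := stepProb_mem σ π ω
      exact ⟨(dotProduct_const hm 0).symm.trans_le (dotProduct_mono hm.1 fun s _ => (ih _).1),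
        (dotProduct_mono hm.1 fun s _ => (ih _).2).trans_eq (dotProduct_const hm 1)⟩
    · rw [val_stopRule_of_notMem h]
      exact he _

lemma val_stopRule_mono (he : ∀ s, e s ∈ Set.Icc (0 : ℝ) 1) (ω : FinPath S) :
    Monotone fun k => val (stopRule D e) σ π k ω := by
  refine monotone_nat_of_le_succ fun k => ?_
  induction k generalizing ω with
  | zero =>
    by_cases h : ω.last ∈ D
    · rw [val_stopRule_zero h]
      exact (val_stopRule_mem he _ _).1
    · simp only [val_stopRule_of_notMem h, le_refl]
  | succ k ih =>
    by_cases h : ω.last ∈ D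
    · rw [val_stopRule_succ h, val_stopRule_succ h]
      exact dotProduct_mono (stepProb_mem σ π ω).1 fun s _ => ih _
    · simp only [val_stopRule_of_notMem h, le_refl]

lemma tendsto_val_stopRule (he : ∀ s, e s ∈ Set.Icc (0 : ℝ) 1) (ω : FinPath S) :
    Tendsto (fun k => val (stopRule D e) σ π k ω) atTop (𝓝 (limVal D e σ π ω)) :=
  tendsto_atTop_ciSup (val_stopRule_mono he ω)
    ⟨1, by rintro _ ⟨k, rfl⟩; exact (val_stopRule_mem he _ _).2⟩

lemma val_le_limVal (he : ∀ s, e s ∈ Set.Icc (0 : ℝ) 1) (k : ℕ) (ω : FinPath S) :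
    val (stopRule D e) σ π k ω ≤ limVal D e σ π ω :=
  (val_stopRule_mono he ω).ge_of_tendsto (tendsto_val_stopRule he ω) k

lemma limVal_mem (he : ∀ s, e s ∈ Set.Icc (0 : ℝ) 1) (ω : FinPath S) :
    limVal D e σ π ω ∈ Set.Icc (0 : ℝ) 1 :=
  ⟨(val_stopRule_mem he 0 ω).1.trans (val_le_limVal he 0 ω),
    ciSup_le fun k => (val_stopRule_mem he k ω).2⟩

lemma limVal_of_notMem (h : ω.last ∉ D) : limVal D e σ π ω = e ω.last := by
  simp [limVal, val_stopRule_of_notMem h]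

lemma limVal_of_mem (he : ∀ s, e s ∈ Set.Icc (0 : ℝ) 1) (h : ω.last ∈ D) :
    limVal D e σ π ω = M.stepProb σ π ω ⬝ᵥ fun s => limVal D e σ π (ω.snoc s) := by
  refine tendsto_nhds_unique ((tendsto_val_stopRule he ω).comp (tendsto_add_atTop_nat 1)) ?_
  simp only [Function.comp_def, val_stopRule_succ h]
  exact tendsto_finsetSum _ fun s _ => (tendsto_val_stopRule he _).const_mul _

/-- A supermartingale that dominates the exit payoff dominates the payoff at every finite horizon.
Nonnegativity handles a horizon that runs out inside `D`, where the payoff is `0`. -/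
lemma limVal_le_of_step_le {u : S → ℝ} (hu0 : ∀ s, 0 ≤ u s)
    (hu : ∀ s ∉ D, e s ≤ u s) (h : ∀ τ : FinPath S, τ.last ∈ D → M.stepProb σ π τ ⬝ᵥ u ≤ u τ.last)
    (ω : FinPath S) : limVal D e σ π ω ≤ u ω.last := by
  refine ciSup_le fun k => ?_
  induction k generalizing ω with
  | zero =>
    by_cases hD : ω.last ∈ D
    · rw [val_stopRule_zero hD]
      exact hu0 _
    · rw [val_stopRule_of_notMem hD]
      exact hu _ hD
  | succ k ih =>
    by_cases hD : ω.last ∈ D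
    · rw [val_stopRule_succ hD]
      refine le_trans (dotProduct_mono (stepProb_mem σ π ω).1 fun s _ => ?_) (h ω hD)
      simpa using ih (ω.snoc s)
    · rw [val_stopRule_of_notMem hD]
      exact hu _ hD

end Reach

/-! ### Value iteration for a monotone operator. -/

section Iteration

/-- Value iteration for the one-step operator `O`. -/
noncomputable def iterVal (D : Set S) (e : S → ℝ) (O : (S → ℝ) → S → ℝ) : ℕ → S → ℝ
  | 0 => open Classical in fun s => if s ∈ D then 0 else e s
  | k + 1 => open Classical in fun s => if s ∈ D then O (iterVal D e O k) s else e s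

/-- The limit of value iteration. -/
noncomputable def limIter (D : Set S) (e : S → ℝ) (O : (S → ℝ) → S → ℝ) (s : S) : ℝ :=
  ⨆ k, iterVal D e O k s

/-- A monotone operator that preserves the functions with values in `[0, 1]`. -/
structure IsValueOp (O : (S → ℝ) → S → ℝ) : Prop where
  mono : Monotone O
  mem : ∀ u : S → ℝ, (∀ s, u s ∈ Set.Icc (0 : ℝ) 1) → ∀ s, O u s ∈ Set.Icc (0 : ℝ) 1

variable {D : Set S} {e : S → ℝ} {O : (S → ℝ) → S → ℝ}

lemma iterVal_of_notMem {s : S} (h : s ∉ D) (k : ℕ) : iterVal D e O k s = e s := by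
  cases k <;> simp [iterVal, h]

lemma iterVal_zero {s : S} (h : s ∈ D) : iterVal D e O 0 s = 0 := by
  simp [iterVal, h]

lemma iterVal_succ {s : S} (h : s ∈ D) (k : ℕ) :
    iterVal D e O (k + 1) s = O (iterVal D e O k) s := by
  simp [iterVal, h]

lemma limIter_of_notMem {s : S} (h : s ∉ D) : limIter D e O s = e s := by
  simp [limIter, iterVal_of_notMem h]

lemma iterVal_eq_of_rel (hD : ∀ x y, R x y → (x ∈ D ↔ y ∈ D)) (he : ∀ x y, R x y → e x = e y)
    (hO : ∀ u : S → ℝ, (∀ x y, R x y → u x = u y) → ∀ x y, R x y → O u x = O u y) (k : ℕ) :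
    ∀ x y, R x y → iterVal D e O k x = iterVal D e O k y := by
  induction k with
  | zero =>
    intro x y h
    by_cases hx : x ∈ D
    · rw [iterVal_zero hx, iterVal_zero ((hD x y h).1 hx)]
    · rw [iterVal_of_notMem hx, iterVal_of_notMem (mt (hD x y h).2 hx), he x y h]
  | succ k ih =>
    intro x y h
    by_cases hx : x ∈ D
    · rw [iterVal_succ hx, iterVal_succ ((hD x y h).1 hx), hO _ ih x y h]
    · rw [iterVal_of_notMem hx, iterVal_of_notMem (mt (hD x y h).2 hx), he x y h]

lemma limIter_eq_of_rel (hD : ∀ x y, R x y → (x ∈ D ↔ y ∈ D)) (he : ∀ x y, R x y → e x = e y)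
    (hO : ∀ u : S → ℝ, (∀ x y, R x y → u x = u y) → ∀ x y, R x y → O u x = O u y) :
    ∀ x y, R x y → limIter D e O x = limIter D e O y := fun x y h => by
  simp only [limIter, iterVal_eq_of_rel hD he hO _ x y h]

namespace IsValueOp

variable (hO : IsValueOp O) (he : ∀ s, e s ∈ Set.Icc (0 : ℝ) 1)
include hO he

lemma iterVal_mem (k : ℕ) (s : S) : iterVal D e O k s ∈ Set.Icc (0 : ℝ) 1 := by
  induction k generalizing s with
  | zero =>
    by_cases h : s ∈ D
    · simp [iterVal_zero h]
    · rw [iterVal_of_notMem h]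
      exact he s
  | succ k ih =>
    by_cases h : s ∈ D
    · rw [iterVal_succ h]
      exact hO.mem _ ih s
    · rw [iterVal_of_notMem h]
      exact he s

lemma iterVal_mono : Monotone (iterVal D e O) := by
  refine monotone_nat_of_le_succ fun k => ?_
  induction k with
  | zero =>
    intro s
    by_cases h : s ∈ D
    · rw [iterVal_zero h]
      exact (hO.iterVal_mem he 1 s).1
    · simp only [iterVal_of_notMem h, le_refl]
  | succ k ih =>
    intro s
    by_cases h : s ∈ D
    · rw [iterVal_succ h, iterVal_succ h]
      exact hO.mono ih s
    · simp only [iterVal_of_notMem h, le_refl]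

lemma tendsto_iterVal (s : S) :
    Tendsto (fun k => iterVal D e O k s) atTop (𝓝 (limIter D e O s)) :=
  tendsto_atTop_ciSup (fun _ _ h => hO.iterVal_mono he h s)
    ⟨1, by rintro _ ⟨k, rfl⟩; exact (hO.iterVal_mem he k s).2⟩

lemma iterVal_le_limIter (k : ℕ) : iterVal D e O k ≤ limIter D e O := fun s =>
  Monotone.ge_of_tendsto (f := fun k => iterVal D e O k s)
    (fun _ _ h => hO.iterVal_mono he h s) (hO.tendsto_iterVal he s) k

lemma limIter_mem (s : S) : limIter D e O s ∈ Set.Icc (0 : ℝ) 1 :=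
  ⟨(hO.iterVal_mem he 0 s).1.trans (hO.iterVal_le_limIter he 0 s),
    ciSup_le fun k => (hO.iterVal_mem he k s).2⟩

/-- Monotonicity suffices for this half of the fixed point equation. The other half needs continuity
along the iteration and is treated for each operator separately. -/
lemma limIter_le_op {s : S} (h : s ∈ D) : limIter D e O s ≤ O (limIter D e O) s := by
  refine ciSup_le fun k => ?_
  cases k with
  | zero =>
    rw [iterVal_zero h]
    exact (hO.mem _ (hO.limIter_mem he) s).1
  | succ k =>
    rw [iterVal_succ h]
    exact hO.mono (hO.iterVal_le_limIter he k) s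

end IsValueOp

end Iteration

/-! ### The value when the scheduler minimises. -/

section MaxNature

variable [Nonempty A] {D : Set S} {e : S → ℝ}

lemma isValueOp_minMax : IsValueOp M.minMax where
  mono := minMax_mono
  mem _ hu s := ⟨le_minMax_of_forall_le (fun y => (hu y).1) s,
    minMax_le_of_forall_le (fun y => (hu y).2) s⟩

/-- Suppose nature could beat the limit at `s`. Its answers, one for each of the finitely many
actions, would already beat it against a late iterate, and the next iterate would exceed the limit.
No closedness of the feasible sets is needed. -/
lemma minMax_limIter_le (he : ∀ s, e s ∈ Set.Icc (0 : ℝ) 1) {s : S} (h : s ∈ D) :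
    M.minMax (limIter D e M.minMax) s ≤ limIter D e M.minMax s := by
  by_contra! hlt
  have h1 := lt_minMax_iff.1 hlt
  choose m hm hlt using h1
  have h2 : ∀ᶠ k in atTop, ∀ a, limIter D e M.minMax s < m a ⬝ᵥ iterVal D e M.minMax k := by
    rw [eventually_all]
    intro a
    refine Tendsto.eventually_const_lt (hlt a) ?_
    exact tendsto_finsetSum _ fun s _ => (isValueOp_minMax.tendsto_iterVal he s).const_mul _
  obtain ⟨k, hk⟩ := h2.exists
  have h3 : limIter D e M.minMax s < M.minMax (iterVal D e M.minMax k) s :=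
    lt_minMax_iff.2 fun a => ⟨m a, hm a, hk a⟩
  rw [← iterVal_succ (e := e) (O := M.minMax) h] at h3
  exact h3.not_ge (isValueOp_minMax.iterVal_le_limIter he _ s)

lemma exists_nature_lt_val {k : ℕ} {ω : FinPath S} {c : ℝ}
    (hc : c < iterVal D e M.minMax k ω.last) (σ : M.Scheduler) :
    ∃ π : M.Nature, c < val (stopRule D e) σ π k ω := by
  induction k generalizing ω c with
  | zero =>
    refine ⟨Classical.arbitrary _, ?_⟩
    by_cases h : ω.last ∈ D
    · rwa [val_stopRule_zero h, ← iterVal_zero (e := e) (O := M.minMax) h]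
    · rwa [val_stopRule_of_notMem h, ← iterVal_of_notMem (e := e) (O := M.minMax) h 0]
  | succ k ih =>
    by_cases h : ω.last ∈ D
    · rw [iterVal_succ h] at hc
      obtain ⟨μ, hμ, hlt⟩ := exists_transition_lt (lt_minMax_iff.1 hc) (σ ω)
      -- The strict gain of the first step pays for continuations that are only `δ`-optimal.
      obtain ⟨δ, hδ, hδ'⟩ := exists_between (sub_pos.2 hlt)
      have h1 : ∀ s, ∃ π : M.Nature,
          iterVal D e M.minMax k s + -δ < val (stopRule D e) σ π k (ω.snoc s) := fun s =>
        ih (by simpa using hδ)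
      choose f hf using h1
      obtain ⟨π, hπ, hπ'⟩ := exists_nature_branch hμ f
      refine ⟨π, ?_⟩
      rw [val_stopRule_succ h, hπ]
      calc c < μ ⬝ᵥ iterVal D e M.minMax k + -δ := by linarith
        _ = μ ⬝ᵥ fun s => iterVal D e M.minMax k s + -δ := (dotProduct_add_const hμ.mem _ _).symm
        _ ≤ _ := dotProduct_mono hμ.mem.1 fun s _ => by
          rw [hπ']
          exact (hf s).le
    · rw [iterVal_of_notMem h] at hc
      exact ⟨Classical.arbitrary _, by rwa [val_stopRule_of_notMem h]⟩

lemma exists_nature_lt_limVal (he : ∀ s, e s ∈ Set.Icc (0 : ℝ) 1) {ω : FinPath S} {c : ℝ}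
    (hc : c < limIter D e M.minMax ω.last) (σ : M.Scheduler) :
    ∃ π : M.Nature, c < limVal D e σ π ω := by
  obtain ⟨k, hk⟩ := exists_lt_of_lt_ciSup hc
  obtain ⟨π, hπ⟩ := exists_nature_lt_val hk σ
  exact ⟨π, hπ.trans_le (val_le_limVal he k ω)⟩

end MaxNature

end IMDP

namespace IMDP

open Filter Topology

variable {S A AP : Type*} [Fintype S] [Fintype A] {M : IMDP S A AP} {R : Setoid S}

/-! ### The value when the scheduler maximises. -/

section MinNature

/-- The discounted optimal expected value of `u` after one step, when the scheduler maximises and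
nature minimises. -/
noncomputable def maxMin (M : IMDP S A AP) (γ : ℝ) (u : S → ℝ) (x : S) : ℝ :=
  -(γ * M.minMax (-u) x)

variable [Nonempty A] {D : Set S} {e : S → ℝ}

lemma isValueOp_maxMin {γ : ℝ} (hγ : γ ∈ Set.Icc (0 : ℝ) 1) : IsValueOp (M.maxMin γ) where
  mono u v h x := neg_le_neg (mul_le_mul_of_nonneg_left (minMax_mono (neg_le_neg h) x) hγ.1)
  mem u hu x := by
    have h1 : M.minMax (-u) x ≤ 0 := minMax_le_of_forall_le (fun y => neg_nonpos.2 (hu y).1) x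
    have h2 : -1 ≤ M.minMax (-u) x := le_minMax_of_forall_le (fun y => neg_le_neg (hu y).2) x
    constructor
    · exact neg_nonneg.2 (mul_nonpos_of_nonneg_of_nonpos hγ.1 h1)
    · unfold maxMin
      nlinarith [hγ.1, hγ.2]

lemma isValueOp_maxMin_one : IsValueOp (M.maxMin 1) := isValueOp_maxMin (by simp)

lemma IsBisimulation.maxMin_eq (hR : M.IsBisimulation R) (γ : ℝ) {u : S → ℝ}
    (hu : ∀ x y, R x y → u x = u y) {x y : S} (h : R x y) : M.maxMin γ u x = M.maxMin γ u y := by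
  unfold maxMin
  rw [hR.minMax_eq (u := -u) (fun x y h => by simp [hu x y h]) h]

/-- Otherwise `a` would guarantee `c` against the limit, hence `c - δ` against a late iterate, and
the next iterate would exceed the limit at `s`. -/
lemma exists_feasible_lt (he : ∀ s, e s ∈ Set.Icc (0 : ℝ) 1) {s : S} (h : s ∈ D) (a : A) {c : ℝ}
    (hc : limIter D e (M.maxMin 1) s < c) :
    ∃ μ ∈ M.feasible s a, μ ⬝ᵥ limIter D e (M.maxMin 1) < c := by
  by_contra! hcon
  set W := limIter D e (M.maxMin 1) with hW
  obtain ⟨δ, hδ, hδ'⟩ := exists_between (sub_pos.2 hc)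
  have h1 : ∀ᶠ k in atTop, ∀ y, W y - δ < iterVal D e (M.maxMin 1) k y := by
    rw [eventually_all]
    intro y
    exact (isValueOp_maxMin_one.tendsto_iterVal he y).eventually_const_lt (by linarith)
  obtain ⟨k, hk⟩ := h1.exists
  have h2 : M.minMax (-iterVal D e (M.maxMin 1) k) s ≤ -(c - δ) := by
    refine minMax_le_iff.2 ⟨a, fun μ hμ => ?_⟩
    rw [dotProduct_neg, neg_le_neg_iff]
    calc c - δ ≤ μ ⬝ᵥ W + -δ := by linarith [hcon μ hμ]
      _ = μ ⬝ᵥ fun y => W y + -δ := (dotProduct_add_const hμ.1 _ _).symm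
      _ ≤ _ := dotProduct_mono hμ.1.1 fun y _ => by linarith [hk y]
  have h3 : iterVal D e (M.maxMin 1) (k + 1) s ≤ W s :=
    isValueOp_maxMin_one.iterVal_le_limIter he _ s
  rw [iterVal_succ h, maxMin] at h3
  linarith

/-- At time `n` nature answers every action up to an error `ε / 2 ^ (n + 1)`; the errors from time
`n` on add up to at most `ε / 2 ^ n`. -/
lemma exists_nature_limVal_le (he : ∀ s, e s ∈ Set.Icc (0 : ℝ) 1) (ω : FinPath S) {c : ℝ}
    (hc : limIter D e (M.maxMin 1) ω.last < c) (σ : M.Scheduler) :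
    ∃ π : M.Nature, limVal D e σ π ω ≤ c := by
  set W := limIter D e (M.maxMin 1) with hW
  obtain ⟨ε, hε, hc'⟩ : ∃ ε, 0 < ε ∧ c = W ω.last + ε := ⟨c - W ω.last, by linarith, by ring⟩
  have h1 : ∀ (τ : FinPath S) (a : A), ∃ m : M.feasible τ.last a,
      τ.last ∈ D → m.1 ⬝ᵥ W ≤ W τ.last + ε / 2 ^ (τ.1 + 1) := by
    intro τ a
    by_cases h : τ.last ∈ D
    · obtain ⟨μ, hμ, hlt⟩ := exists_feasible_lt (M := M) he h a
        (c := W τ.last + ε / 2 ^ (τ.1 + 1)) (lt_add_of_pos_right _ (by positivity))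
      exact ⟨⟨μ, hμ⟩, fun _ => hlt.le⟩
    · exact ⟨⟨_, (M.feasible_nonempty' τ.last a).choose_spec⟩, fun h' => absurd h' h⟩
  choose π hπ using h1
  refine ⟨π, ?_⟩
  have key : ∀ k (τ : FinPath S), val (stopRule D e) σ π k τ ≤ W τ.last + ε / 2 ^ τ.1 := by
    intro k
    induction k with
    | zero =>
      intro τ
      have hp : 0 ≤ ε / 2 ^ τ.1 := by positivity
      by_cases h : τ.last ∈ D
      · rw [val_stopRule_zero h]
        linarith [(isValueOp_maxMin_one (M := M)).limIter_mem (D := D) he τ.last |>.1]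
      · rw [val_stopRule_of_notMem h, hW, limIter_of_notMem h]
        linarith
    | succ k ih =>
      intro τ
      have hp : 0 ≤ ε / 2 ^ τ.1 := by positivity
      by_cases h : τ.last ∈ D
      · rw [val_stopRule_succ h]
        have hm := stepProb_mem σ π τ
        have h2 : M.stepProb σ π τ ⬝ᵥ W ≤ W τ.last + ε / 2 ^ (τ.1 + 1) := by
          calc M.stepProb σ π τ ⬝ᵥ W = (σ τ).1 ⬝ᵥ fun a => (π τ a).1 ⬝ᵥ W :=
                sum_mul_dotProduct _ _ _
            _ ≤ (σ τ).1 ⬝ᵥ fun _ => W τ.last + ε / 2 ^ (τ.1 + 1) :=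
                dotProduct_mono (σ τ).2.1 fun a _ => hπ τ a h
            _ = _ := dotProduct_const (σ τ).2 _
        calc M.stepProb σ π τ ⬝ᵥ (fun s => val (stopRule D e) σ π k (τ.snoc s))
            ≤ M.stepProb σ π τ ⬝ᵥ fun s => W s + ε / 2 ^ (τ.1 + 1) :=
              dotProduct_mono hm.1 fun s _ =>
                (ih (τ.snoc s)).trans_eq (by rw [FinPath.last_snoc]; rfl)
          _ = M.stepProb σ π τ ⬝ᵥ W + ε / 2 ^ (τ.1 + 1) := dotProduct_add_const hm _ _
          _ ≤ W τ.last + ε / 2 ^ (τ.1 + 1) + ε / 2 ^ (τ.1 + 1) := by linarith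
          _ = W τ.last + ε / 2 ^ τ.1 := by
            rw [pow_succ]
            field_simp
            ring
      · rw [val_stopRule_of_notMem h, hW, limIter_of_notMem h]
        linarith
  refine ciSup_le fun k => (key k ω).trans ?_
  rw [hc']
  gcongr
  exact div_le_self hε.le (one_le_pow₀ (by norm_num))

lemma exists_action_discount {γ : ℝ} (hγ : γ ∈ Set.Icc (0 : ℝ) 1)
    (he : ∀ s, e s ∈ Set.Icc (0 : ℝ) 1) {s : S} (h : s ∈ D) :
    ∃ a, ∀ μ ∈ M.feasible s a,
      limIter D e (M.maxMin γ) s ≤ γ * (μ ⬝ᵥ limIter D e (M.maxMin γ)) := by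
  obtain ⟨a, ha⟩ := minMax_le_iff.1 (le_refl (M.minMax (-limIter D e (M.maxMin γ)) s))
  refine ⟨a, fun μ hμ => ((isValueOp_maxMin hγ).limIter_le_op he h).trans ?_⟩
  have h1 := ha μ hμ
  rw [dotProduct_neg] at h1
  unfold maxMin at h1 ⊢
  have := mul_le_mul_of_nonneg_left h1 hγ.1
  linarith

/-- Each step of the iteration loses at most one factor `γ`. -/
lemma pow_mul_iterVal_le {γ : ℝ} (hγ : γ ∈ Set.Icc (0 : ℝ) 1)
    (he : ∀ s, e s ∈ Set.Icc (0 : ℝ) 1) (k : ℕ) (s : S) :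
    γ ^ k * iterVal D e (M.maxMin 1) k s ≤ iterVal D e (M.maxMin γ) k s := by
  induction k generalizing s with
  | zero =>
    by_cases h : s ∈ D
    · simp [iterVal_zero h]
    · simp [iterVal_of_notMem h]
  | succ k ih =>
    by_cases h : s ∈ D
    · rw [iterVal_succ h, iterVal_succ h]
      obtain ⟨a, ha⟩ := minMax_le_iff.1 (le_refl (M.minMax (-iterVal D e (M.maxMin 1) k) s))
      have h1 : M.minMax (-iterVal D e (M.maxMin γ) k) s ≤
          γ ^ k * M.minMax (-iterVal D e (M.maxMin 1) k) s := by
        refine minMax_le_iff.2 ⟨a, fun μ hμ => ?_⟩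
        calc μ ⬝ᵥ -iterVal D e (M.maxMin γ) k
            ≤ μ ⬝ᵥ (γ ^ k • -iterVal D e (M.maxMin 1) k) :=
              dotProduct_mono hμ.1.1 fun y _ => by simpa using ih y
          _ = γ ^ k * (μ ⬝ᵥ -iterVal D e (M.maxMin 1) k) := by rw [dotProduct_smul, smul_eq_mul]
          _ ≤ _ := mul_le_mul_of_nonneg_left (ha μ hμ) (pow_nonneg hγ.1 k)
      unfold maxMin at h1 ⊢
      have := mul_le_mul_of_nonneg_left h1 hγ.1
      rw [pow_succ]
      linarith
    · rw [iterVal_of_notMem h, iterVal_of_notMem h]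
      exact mul_le_of_le_one_left (he s).1 (pow_le_one₀ hγ.1 hγ.2)

/-- Without a discount, locally optimal actions may keep the play in `D` forever with payoff `0`.
With `γ < 1`, the loss from a horizon that runs out decays like `γ ^ k`. -/
lemma discount_le_val {γ : ℝ} (hγ : γ ∈ Set.Icc (0 : ℝ) 1)
    (he : ∀ s, e s ∈ Set.Icc (0 : ℝ) 1) {d : S → A}
    (hd : ∀ s ∈ D, ∀ μ ∈ M.feasible s (d s),
      limIter D e (M.maxMin γ) s ≤ γ * (μ ⬝ᵥ limIter D e (M.maxMin γ)))
    {σ : M.Scheduler} {π : M.Nature} (hσ : ∀ τ : FinPath S,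
      M.stepProb σ π τ ∈ M.feasible τ.last (d τ.last)) (k : ℕ) (ω : FinPath S) :
    limIter D e (M.maxMin γ) ω.last - γ ^ k ≤ val (stopRule D e) σ π k ω := by
  set L := limIter D e (M.maxMin γ) with hL
  induction k generalizing ω with
  | zero =>
    have := ((isValueOp_maxMin (M := M) hγ).limIter_mem (D := D) he ω.last).2
    have h2 := (val_stopRule_mem (D := D) (σ := σ) (π := π) he 0 ω).1
    rw [pow_zero]
    linarith
  | succ k ih =>
    by_cases h : ω.last ∈ D
    · rw [val_stopRule_succ h]
      set ν := M.stepProb σ π ω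
      set v : S → ℝ := fun s => val (stopRule D e) σ π k (ω.snoc s)
      have hν : ν ∈ stdSimplex ℝ S := stepProb_mem σ π ω
      have h0 : 0 ≤ ν ⬝ᵥ v := Finset.sum_nonneg fun s _ =>
        mul_nonneg (hν.1 s) (val_stopRule_mem he k _).1
      have h1 : ν ⬝ᵥ L + -γ ^ k ≤ ν ⬝ᵥ v := by
        rw [← dotProduct_add_const hν]
        exact dotProduct_mono hν.1 fun s _ => by simpa [sub_eq_add_neg] using ih (ω.snoc s)
      have h2 := hd _ h ν (hσ ω)
      have h3 := mul_le_mul_of_nonneg_left h1 hγ.1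
      have h4 : γ * (ν ⬝ᵥ v) ≤ ν ⬝ᵥ v := mul_le_of_le_one_left h0 hγ.2
      rw [pow_succ]
      linarith
    · rw [val_stopRule_of_notMem h, hL, limIter_of_notMem h]
      linarith [pow_nonneg hγ.1 (k + 1)]

/-- The scheduler has an optimal memoryless strategy if it maximises the payoff. -/
lemma exists_scheduler_le_limVal (he : ∀ s, e s ∈ Set.Icc (0 : ℝ) 1) :
    ∃ σ : M.Scheduler, ∀ (π : M.Nature) (ω : FinPath S),
      limIter D e (M.maxMin 1) ω.last ≤ limVal D e σ π ω := by
  let γ : ℕ → ℝ := fun n => 1 - 1 / ((n : ℝ) + 1)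
  have hγpos : ∀ n : ℕ, 0 < 1 / ((n : ℝ) + 1) := fun n => by positivity
  have hγ : ∀ n, γ n ∈ Set.Icc (0 : ℝ) 1 := fun n => by
    have : 1 / ((n : ℝ) + 1) ≤ 1 := by
      rw [div_le_one (by positivity)]
      linarith [(Nat.cast_nonneg n : (0 : ℝ) ≤ n)]
    exact ⟨sub_nonneg.2 this, by linarith [hγpos n, (rfl : γ n = 1 - 1 / ((n : ℝ) + 1))]⟩
  have hγlt : ∀ n, γ n < 1 := fun n => by
    linarith [hγpos n, (rfl : γ n = 1 - 1 / ((n : ℝ) + 1))]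
  have hγlim : Tendsto γ atTop (𝓝 1) := by
    have := (tendsto_const_nhds (x := (1 : ℝ))).sub
      (tendsto_one_div_add_atTop_nhds_zero_nat (𝕜 := ℝ))
    rwa [sub_zero] at this
  have h1 : ∀ n, ∃ d : S → A, ∀ s ∈ D, ∀ μ ∈ M.feasible s (d s),
      limIter D e (M.maxMin (γ n)) s ≤ γ n * (μ ⬝ᵥ limIter D e (M.maxMin (γ n))) := by
    intro n
    have : ∀ s, ∃ a, s ∈ D → ∀ μ ∈ M.feasible s a,
        limIter D e (M.maxMin (γ n)) s ≤ γ n * (μ ⬝ᵥ limIter D e (M.maxMin (γ n))) := by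
      intro s
      by_cases h : s ∈ D
      · obtain ⟨a, ha⟩ := exists_action_discount (M := M) (hγ n) he h
        exact ⟨a, fun _ => ha⟩
      · exact ⟨Classical.arbitrary A, fun h' => absurd h' h⟩
    choose d hd using this
    exact ⟨d, hd⟩
  choose d hd using h1
  -- There are finitely many memoryless policies, so one of them serves infinitely many of the
  -- discounts `γ n`, which tend to `1`.
  obtain ⟨d₀, hd₀⟩ := Finite.exists_infinite_fiber d
  have hfreq : ∃ᶠ n in atTop, d n = d₀ := by
    rw [Nat.frequently_atTop_iff_infinite]
    exact Set.infinite_coe_iff.1 hd₀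
  choose ρ hρ using fun s => exists_dirac (M := M) s (d₀ s)
  refine ⟨fun τ => ρ τ.last, fun π ω => ciSup_le fun k => ?_⟩
  have h2 : ∃ᶠ n in atTop, γ n ^ k * iterVal D e (M.maxMin 1) k ω.last ≤
      limVal D e (fun τ => ρ τ.last) π ω := by
    refine hfreq.mono fun n hn => ?_
    refine (pow_mul_iterVal_le (hγ n) he k ω.last).trans
      (((isValueOp_maxMin (hγ n)).iterVal_le_limIter he k ω.last).trans ?_)
    have h3 : Tendsto (fun j => limIter D e (M.maxMin (γ n)) ω.last - γ n ^ j) atTop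
        (𝓝 (limIter D e (M.maxMin (γ n)) ω.last - 0)) :=
      tendsto_const_nhds.sub (tendsto_pow_atTop_nhds_zero_of_lt_one (hγ n).1 (hγlt n))
    rw [sub_zero] at h3
    refine le_of_tendsto h3 (Eventually.of_forall fun j => ?_)
    refine le_trans ?_ (val_le_limVal he j ω)
    exact discount_le_val (hγ n) he (hn ▸ hd n)
      (fun τ => hρ τ.last _ (transition_stepProb (fun τ => ρ τ.last) π τ)) j ω
  have h4 : Tendsto (fun n => γ n ^ k * iterVal D e (M.maxMin 1) k ω.last) atTop
      (𝓝 (1 ^ k * iterVal D e (M.maxMin 1) k ω.last)) := (hγlim.pow k).mul_const _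
  rw [one_pow, one_mul] at h4
  exact le_of_tendsto_of_frequently h4 h2

end MinNature

end IMDP

namespace IMDP

set_option linter.unusedSectionVars false

open Filter Topology

variable {S A AP : Type*} [Fintype S] [Fintype A] {M : IMDP S A AP} {R : Setoid S}

/-! ### Traps and ranks. -/

section Trap

/-- In the states of `X` the scheduler `ρ` does not let the expected value of `u` increase, and if
nature keeps this value constant then the rank `r` decreases with positive probability or (if `stay`
is allowed) the play remains in `X` without increasing the rank. -/
def IsTrap (M : IMDP S A AP) (u : S → ℝ) (D : Set S) (stay : Prop) (X : Set S) (r : S → ℕ)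
    (ρ : S → stdSimplex ℝ A) : Prop :=
  ∀ x ∈ X, x ∈ D ∧ (∀ μ, M.Transition x (ρ x) μ → μ ⬝ᵥ u ≤ u x) ∧
    ∀ μ, M.Transition x (ρ x) μ → μ ⬝ᵥ u = u x →
      (∃ y ∈ X, r y < r x ∧ 0 < μ y) ∨ (stay ∧ ∀ y, 0 < μ y → y ∈ X ∧ r y ≤ r x)

variable {u : S → ℝ} {D X : Set S} {stay : Prop} {r : S → ℕ} {ρ : S → stdSimplex ℝ A}

/-- The closure of a trap under a bisimulation is a trap. -/
lemma IsTrap.saturate (hR : M.IsBisimulation R) (hu : ∀ x y, R x y → u x = u y)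
    (hD : ∀ x y, R x y → (x ∈ D ↔ y ∈ D)) (h : M.IsTrap u D stay X r ρ) :
    ∃ r' ρ', M.IsTrap u D stay {t | ∃ x ∈ X, R x t} r' ρ' := by
  -- At `t`, imitate the related state of `X` of least rank. Passing to a related successor then
  -- never raises the rank.
  have h1 : ∀ t, ∃ x, t ∈ {t | ∃ x ∈ X, R x t} →
      x ∈ X ∧ R x t ∧ ∀ y ∈ X, R y t → r x ≤ r y := by
    intro t
    by_cases ht : t ∈ {t | ∃ x ∈ X, R x t}
    · obtain ⟨x, hx⟩ := (Set.toFinite {x | x ∈ X ∧ R x t}).exists_minimalFor r _ ht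
      exact ⟨x, fun _ => ⟨hx.1.1, hx.1.2, fun y hy hyt =>
        (le_total (r x) (r y)).elim id fun h => hx.2 ⟨hy, hyt⟩ h⟩⟩
    · exact ⟨t, fun h => absurd h ht⟩
  choose x hx using h1
  have h2 : ∀ t, ∃ ρ' : stdSimplex ℝ A, t ∈ {t | ∃ x ∈ X, R x t} →
      ∀ ν, M.Transition t ρ' ν → ∃ μ, M.Transition (x t) (ρ (x t)) μ ∧
        ∀ u : S → ℝ, (∀ x y, R x y → u x = u y) → μ ⬝ᵥ u = ν ⬝ᵥ u := by
    intro t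
    by_cases ht : t ∈ {t | ∃ x ∈ X, R x t}
    · obtain ⟨ρ', h'⟩ := hR.exists_match (hx t ht).2.1 (ρ (x t))
      exact ⟨ρ', fun _ => h'⟩
    · exact ⟨ρ t, fun h => absurd h ht⟩
  choose ρ' hρ' using h2
  refine ⟨fun t => r (x t), ρ', fun t ht => ?_⟩
  obtain ⟨hxX, hxt, -⟩ := hx t ht
  obtain ⟨hxD, hle, htrap⟩ := h _ hxX
  refine ⟨(hD _ _ hxt).1 hxD, fun ν hν => ?_, fun ν hν hνu => ?_⟩
  · obtain ⟨μ, hμ, he⟩ := hρ' t ht ν hν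
    rw [← he u hu, ← hu _ _ hxt]
    exact hle μ hμ
  · obtain ⟨μ, hμ, he⟩ := hρ' t ht ν hν
    have he' : ∀ u : S → ℝ, (∀ x y, R x y → u x = u y) → ν ⬝ᵥ u = μ ⬝ᵥ u :=
      fun u hu => (he u hu).symm
    rw [← he u hu, ← hu _ _ hxt] at hνu
    rcases htrap μ hμ hνu with ⟨y, hy, hry, hpos⟩ | ⟨hs, hall⟩
    · obtain ⟨z, hyz, hz⟩ := exists_pos_of_dotProduct_eq hν.mem.1 hμ.mem.1 he' hpos
      have hzX : z ∈ {t | ∃ x ∈ X, R x t} := ⟨y, hy, hyz⟩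
      exact Or.inl ⟨z, hzX, ((hx z hzX).2.2 y hy hyz).trans_lt hry, hz⟩
    · refine Or.inr ⟨hs, fun z hz => ?_⟩
      obtain ⟨y, hzy, hy⟩ := exists_pos_of_dotProduct_eq hμ.mem.1 hν.mem.1 he hz
      obtain ⟨hyX, hry⟩ := hall y hy
      have hzX : z ∈ {t | ∃ x ∈ X, R x t} := ⟨y, hyX, R.symm hzy⟩
      exact ⟨hzX, ((hx z hzX).2.2 y hyX (R.symm hzy)).trans hry⟩

/-- There is a trap that is invariant under a bisimulation and such that no nonempty set can be
added to it. -/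
lemma IsBisimulation.exists_trap [Nonempty A] (hR : M.IsBisimulation R)
    (hu : ∀ x y, R x y → u x = u y) (hD : ∀ x y, R x y → (x ∈ D ↔ y ∈ D)) (stay : Prop) :
    ∃ X r ρ, M.IsTrap u D stay X r ρ ∧ (∀ x y, R x y → x ∈ X → y ∈ X) ∧
      ∀ Y ⊆ D \ X, Y.Nonempty → ∃ y ∈ Y, ∀ ρ : stdSimplex ℝ A,
        (∀ μ, M.Transition y ρ μ → μ ⬝ᵥ u ≤ u y) → ∃ μ, M.Transition y ρ μ ∧ μ ⬝ᵥ u = u y ∧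
          (∀ x ∈ X, ¬ 0 < μ x) ∧ (stay → ∃ z ∉ Y, 0 < μ z) := by
  classical
  obtain ⟨X, ⟨r, ρ, hX⟩, hmax⟩ := (Set.toFinite {X | ∃ r ρ, M.IsTrap u D stay X r ρ}).exists_maximalFor
    id _ ⟨∅, fun _ => 0, fun _ => ⟨Pi.single (Classical.arbitrary A) 1, single_mem_stdSimplex ℝ _⟩,
      fun x hx => absurd hx (Set.notMem_empty x)⟩
  refine ⟨X, r, ρ, hX, fun x y hxy hx => ?_, fun Y hYD hY => ?_⟩
  · obtain ⟨r', ρ', h'⟩ := hX.saturate hR hu hD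
    exact hmax (j := {t | ∃ x ∈ X, R x t}) ⟨r', ρ', h'⟩ (fun x hx => ⟨x, hx, R.refl x⟩) ⟨x, hx, hxy⟩
  · by_contra! hcon
    have h1 : ∀ y, ∃ ρ' : stdSimplex ℝ A, y ∈ Y → (∀ μ, M.Transition y ρ' μ → μ ⬝ᵥ u ≤ u y) ∧
        ∀ μ, M.Transition y ρ' μ → μ ⬝ᵥ u = u y → (∀ x ∈ X, ¬ 0 < μ x) →
          stay ∧ ∀ z ∉ Y, ¬ 0 < μ z := by
      intro y
      by_cases hy : y ∈ Y
      · obtain ⟨ρ', hle, h'⟩ := hcon y hy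
        refine ⟨ρ', fun _ => ⟨hle, fun μ hμ he hx => ?_⟩⟩
        obtain ⟨hs, hz⟩ := h' μ hμ he fun x hxX => not_lt.1 (hx x hxX)
        exact ⟨hs, fun z hzY => not_lt.2 (hz z hzY)⟩
      · exact ⟨ρ y, fun h => absurd h hy⟩
    choose ρ' hρ' using h1
    -- All new states receive the rank `N`, above every old one: entering `X` lowers the rank, and
    -- moving within `Y` does not raise it.
    obtain ⟨N, hN⟩ : ∃ N, ∀ x, r x < N := by
      obtain ⟨N, hN⟩ := (Set.finite_range r).bddAbove
      exact ⟨N + 1, fun x => Nat.lt_succ_of_le (hN ⟨x, rfl⟩)⟩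
    have hext : M.IsTrap u D stay (X ∪ Y) (fun x => if x ∈ X then r x else N)
        (fun x => if x ∈ X then ρ x else ρ' x) := by
      intro x hx
      by_cases hxX : x ∈ X
      · simp only [if_pos hxX]
        obtain ⟨h1, h2, h3⟩ := hX x hxX
        refine ⟨h1, h2, fun μ hμ he => ?_⟩
        rcases h3 μ hμ he with ⟨y, hy, hry, hpos⟩ | ⟨hs, hall⟩
        · exact Or.inl ⟨y, Or.inl hy, by rwa [if_pos hy], hpos⟩
        · refine Or.inr ⟨hs, fun y hy => ?_⟩
          obtain ⟨hyX, hry⟩ := hall y hy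
          exact ⟨Or.inl hyX, by rwa [if_pos hyX]⟩
      · have hxY : x ∈ Y := hx.resolve_left hxX
        simp only [if_neg hxX]
        obtain ⟨h2, h3⟩ := hρ' x hxY
        refine ⟨(hYD hxY).1, h2, fun μ hμ he => ?_⟩
        by_cases hpos : ∃ y ∈ X, 0 < μ y
        · obtain ⟨y, hy, hpos⟩ := hpos
          exact Or.inl ⟨y, Or.inl hy, by rw [if_pos hy]; exact hN y, hpos⟩
        · push Not at hpos
          obtain ⟨hs, hz⟩ := h3 μ hμ he fun y hy => not_lt.2 (hpos y hy)
          refine Or.inr ⟨hs, fun y hy => ⟨Or.inr (by_contra fun h => hz y h hy), ?_⟩⟩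
          split_ifs
          exacts [(hN y).le, le_rfl]
    obtain ⟨y, hy⟩ := hY
    exact (hYD hy).2 (hmax (j := X ∪ Y) ⟨_, _, hext⟩ (fun x hx => Or.inl hx) (Or.inr hy))

/-- If every nonempty subset of `H` contains a point that makes progress out of this subset, then
there is a rank that can be decreased everywhere in `H`. -/
lemma exists_rank {Prog : S → Set S → Prop} (hmono : ∀ y Z Z', Z ⊆ Z' → Prog y Z → Prog y Z')
    (H : Finset S) (h : ∀ Y : Set S, Y ⊆ H → Y.Nonempty → ∃ y ∈ Y, Prog y Yᶜ) :
    ∃ q : S → ℕ, (∀ y ∉ H, q y = 0) ∧ ∀ y ∈ H, Prog y {z | q z < q y} := by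
  classical
  induction H using Finset.strongInduction with
  | H H ih =>
    rcases H.eq_empty_or_nonempty with rfl | hne
    · exact ⟨fun _ => 0, by simp, by simp⟩
    · obtain ⟨y₁, hy₁, hp⟩ := h H subset_rfl hne
      have hy₁' : y₁ ∈ H := hy₁
      obtain ⟨q, hq0, hq⟩ := ih (H.erase y₁) (Finset.erase_ssubset hy₁') fun Y hY =>
        h Y (hY.trans (by simp))
      -- The point `y₁` progresses out of `H` and gets rank `1`. The shift by `2` puts both `y₁` and
      -- the complement of `H` below all other points.
      refine ⟨fun y => if y ∈ H then (if y = y₁ then 1 else q y + 2) else 0, ?_, fun y hy => ?_⟩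
      · intro y hy
        simp [hy]
      · by_cases hyy : y = y₁
        · subst hyy
          refine hmono _ _ _ ?_ hp
          intro z hz
          have : z ∉ H := hz
          simp [this, hy₁']
        · refine hmono _ _ _ ?_ (hq y (Finset.mem_erase.2 ⟨hyy, hy⟩))
          intro z hz
          have hz' : q z < q y := hz
          simp only [Set.mem_ofPred_eq, if_pos hy, if_neg hyy]
          split_ifs <;> omega

end Trap

/-! ### Strict improvement on `W`, and natures that attain it. -/

section StrictMin

variable [Nonempty A] {D X : Set S} {e : S → ℝ} {r : S → ℕ} {ρ : S → stdSimplex ℝ A}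

lemma limVal_congr {σ σ' : M.Scheduler} {π π' : M.Nature} {ω : FinPath S}
    (h : ∀ g k, val g σ π k ω = val g σ' π' k ω) : limVal D e σ π ω = limVal D e σ' π' ω := by
  simp only [limVal, h]

/-- In a trap for `-W`, the scheduler achieves strictly more than the optimal value `W`. -/
lemma IsTrap.exists_scheduler_lt_limVal (he : ∀ s, e s ∈ Set.Icc (0 : ℝ) 1)
    (hX : M.IsTrap (-limIter D e (M.maxMin 1)) D False X r ρ) (n : ℕ) (ω : FinPath S)
    (hω : ω.last ∈ X) (hr : r ω.last < n) :
    ∃ σ : M.Scheduler, ∀ π : M.Nature, limIter D e (M.maxMin 1) ω.last < limVal D e σ π ω := by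
  set W := limIter D e (M.maxMin 1) with hW
  induction n generalizing ω with
  | zero => exact absurd hr (Nat.not_lt_zero _)
  | succ n ih =>
    obtain ⟨σ₀, hσ₀⟩ := exists_scheduler_le_limVal (M := M) (D := D) he
    -- After a successor of smaller rank the strict gain comes from the induction hypothesis; after
    -- any other one an optimal scheduler avoids a loss.
    have h1 : ∀ s, ∃ σ : M.Scheduler, (∀ π, W s ≤ limVal D e σ π (ω.snoc s)) ∧
        (s ∈ X → r s < r ω.last → ∀ π, W s < limVal D e σ π (ω.snoc s)) := by
      intro s
      by_cases hs : s ∈ X ∧ r s < r ω.last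
      · obtain ⟨σ, hσ⟩ := ih (ω.snoc s) (by simpa using hs.1) (by simp; omega)
        simp only [FinPath.last_snoc] at hσ
        exact ⟨σ, fun π => (hσ π).le, fun _ _ => hσ⟩
      · exact ⟨σ₀, fun π => by simpa using hσ₀ π (ω.snoc s), fun h h' => absurd ⟨h, h'⟩ hs⟩
    choose f hf hf' using h1
    obtain ⟨σ, hσω, hσ⟩ := exists_scheduler_branch (M := M) ω (ρ ω.last) f
    refine ⟨σ, fun π => ?_⟩
    obtain ⟨hD, hle, htrap⟩ := hX _ hω
    have ht : M.Transition ω.last (ρ ω.last) (M.stepProb σ π ω) := hσω ▸ transition_stepProb σ π ω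
    rw [limVal_of_mem he hD]
    have h2 : ∀ s, limVal D e σ π (ω.snoc s) = limVal D e (f s) π (ω.snoc s) := fun s =>
      limVal_congr fun g k => hσ g π k s
    simp only [h2]
    have h3 := hle _ ht
    simp only [dotProduct_neg, Pi.neg_apply, neg_le_neg_iff] at h3
    rcases h3.lt_or_eq with hlt | heq
    · exact hlt.trans_le (dotProduct_mono ht.mem.1 fun s _ => hf s π)
    · rcases htrap _ ht (by simp [dotProduct_neg, heq]) with ⟨y, hy, hry, hpos⟩ | ⟨hs, -⟩
      · rw [heq]
        exact dotProduct_strictMono ht.mem.1 (fun s _ => hf s π) ⟨y, hpos, hf' y hy hry π⟩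
      · exact hs.elim

/-- Outside a maximal trap for `-W`, nature can achieve the optimal value `W`. -/
lemma exists_nature_limVal_le_of_notMem (he : ∀ s, e s ∈ Set.Icc (0 : ℝ) 1)
    (hX : ∀ Y ⊆ D \ X, Y.Nonempty → ∃ y ∈ Y, ∀ ρ : stdSimplex ℝ A,
        (∀ μ, M.Transition y ρ μ → μ ⬝ᵥ (-limIter D e (M.maxMin 1)) ≤
          (-limIter D e (M.maxMin 1)) y) →
        ∃ μ, M.Transition y ρ μ ∧
          μ ⬝ᵥ (-limIter D e (M.maxMin 1)) = (-limIter D e (M.maxMin 1)) y ∧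
          (∀ x ∈ X, ¬ 0 < μ x) ∧ (False → ∃ z ∉ Y, 0 < μ z))
    {s : S} (hs : s ∉ X) (σ : M.Scheduler) :
    ∃ π : M.Nature, limVal D e σ π ⟨0, fun _ => s⟩ ≤ limIter D e (M.maxMin 1) s := by
  set W := limIter D e (M.maxMin 1) with hW
  let K : FinPath S → Prop := fun τ => ∃ π : M.Nature, limVal D e σ π τ ≤ W τ.last
  have hKD : ∀ τ, ¬ K τ → τ.last ∈ D := by
    intro τ hK
    by_contra h
    refine hK ⟨Classical.arbitrary _, ?_⟩
    rw [limVal_of_notMem h, hW, limIter_of_notMem h]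
  -- Where nature cannot yet secure the value, `σ` must be locally optimal: otherwise nature would
  -- gain more than `δ` in this step and could continue `δ`-optimally.
  have hK : ∀ τ, ¬ K τ → ∀ μ, M.Transition τ.last (σ τ) μ → W τ.last ≤ μ ⬝ᵥ W := by
    intro τ hK μ hμ
    by_contra! hlt
    obtain ⟨δ, hδ, hδ'⟩ := exists_between (sub_pos.2 hlt)
    have h1 : ∀ s, ∃ π : M.Nature, limVal D e σ π (τ.snoc s) ≤ W s + δ := fun s =>
      exists_nature_limVal_le he (τ.snoc s) (by rw [FinPath.last_snoc]; linarith) σ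
    choose f hf using h1
    obtain ⟨π, hπ, hπ'⟩ := exists_nature_branch hμ f
    refine hK ⟨π, ?_⟩
    rw [limVal_of_mem he (hKD τ hK), hπ]
    calc (μ ⬝ᵥ fun s => limVal D e σ π (τ.snoc s)) ≤ μ ⬝ᵥ fun s => W s + δ :=
          dotProduct_mono hμ.mem.1 fun s _ => by
            rw [limVal_congr fun g k => hπ' g k s]
            exact hf s
      _ = μ ⬝ᵥ W + δ := dotProduct_add_const hμ.mem _ _
      _ ≤ W τ.last := by linarith
  have h1 : ∀ τ : FinPath S, ∃ m : ∀ a, M.feasible τ.last a, ¬ K τ → τ.last ∉ X →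
      (fun s => ∑ a, (σ τ).1 a * (m a).1 s) ⬝ᵥ W = W τ.last ∧
        ∀ x ∈ X, ¬ 0 < ∑ a, (σ τ).1 a * (m a).1 x := by
    intro τ
    by_cases h : ¬ K τ ∧ τ.last ∉ X
    -- A singleton suffices because no progress is required: a minimising nature is content if the
    -- play never leaves `D`.
    · obtain ⟨y, rfl, hy⟩ := hX {τ.last} (by
        rintro _ rfl
        exact ⟨hKD _ h.1, h.2⟩) ⟨_, rfl⟩
      obtain ⟨μ, ⟨m, hm, hμ⟩, hμW, hμX, -⟩ := hy (σ τ) fun μ hμ => by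
        rw [dotProduct_neg]
        exact neg_le_neg (hK τ h.1 μ hμ)
      rw [dotProduct_neg, Pi.neg_apply, neg_inj] at hμW
      obtain rfl : μ = _ := funext hμ
      exact ⟨fun a => ⟨m a, hm a⟩, fun _ _ => ⟨hμW, hμX⟩⟩
    · exact ⟨(Classical.arbitrary M.Nature) τ, fun h1 h2 => absurd ⟨h1, h2⟩ h⟩
  choose π₀ hπ₀ using h1
  have h2 : ∀ τ, ∃ π : M.Nature, K τ → limVal D e σ π τ ≤ W τ.last := by
    intro τ
    by_cases h : K τ
    · exact ⟨h.choose, fun _ => h.choose_spec⟩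
    · exact ⟨π₀, fun h' => absurd h' h⟩
  choose p hp using h2
  obtain ⟨π, live, hl0, hl, hlK⟩ := FinPath.exists_stitch
    (β := fun τ => ∀ a, M.feasible τ.last a) K π₀ p
  refine ⟨π, ciSup_le fun k => ?_⟩
  have key : ∀ k τ, live τ → τ.last ∉ X → val (stopRule D e) σ π k τ ≤ W τ.last := by
    intro k
    induction k with
    | zero =>
      intro τ _ _
      by_cases h : τ.last ∈ D
      · rw [val_stopRule_zero h]
        exact ((isValueOp_maxMin_one (M := M)).limIter_mem he _).1
      · rw [val_stopRule_of_notMem h, hW, limIter_of_notMem h]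
    | succ k ih =>
      intro τ hτ hτX
      by_cases hKτ : K τ
      · rw [val_congr (k + 1) τ (fun _ _ => rfl) (hlK τ hτ hKτ)]
        exact (val_le_limVal he _ _).trans (hp τ hKτ)
      · obtain ⟨hπτ, hlive⟩ := hl τ hτ hKτ
        rw [val_stopRule_succ (hKD τ hKτ)]
        obtain ⟨hW', hX'⟩ := hπ₀ τ hKτ hτX
        rw [← hπτ] at hW' hX'
        refine le_trans (dotProduct_mono (stepProb_mem σ π τ).1 fun s hs => ?_) hW'.le
        have := ih (τ.snoc s) (hlive s) (by
          rw [FinPath.last_snoc]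
          exact fun h => hX' s h hs)
        rwa [FinPath.last_snoc] at this
  exact key k _ (hl0 _) hs

end StrictMin

end IMDP

namespace IMDP

open Filter Topology

variable {S A AP : Type*} [Fintype S] [Fintype A] {M : IMDP S A AP} {R : Setoid S}

/-! ### Strict improvement on `V`, and natures that attain it. -/

section StrictMax

variable [Nonempty A] {D X : Set S} {e : S → ℝ} {r : S → ℕ} {ρ : S → stdSimplex ℝ A}

/-- The scheduler has an optimal memoryless strategy if it minimises the payoff; in a trap for the
optimal value `V` it achieves strictly less than `V`. -/
lemma IsTrap.exists_scheduler_limVal_lt (he : ∀ s, e s ∈ Set.Icc (0 : ℝ) 1)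
    (hX : M.IsTrap (limIter D e M.minMax) (D ∩ {s | 0 < limIter D e M.minMax s}) True X r ρ) :
    ∃ σ : M.Scheduler, ∀ (π : M.Nature) (ω : FinPath S),
      limVal D e σ π ω ≤ limIter D e M.minMax ω.last ∧
        (ω.last ∈ X → limVal D e σ π ω < limIter D e M.minMax ω.last) := by
  classical
  set V := limIter D e M.minMax with hV
  have h1 : ∀ s, ∃ ρ : stdSimplex ℝ A, s ∈ D → ∀ μ, M.Transition s ρ μ → μ ⬝ᵥ V ≤ V s := by
    intro s
    by_cases h : s ∈ D
    · obtain ⟨ρ, hρ⟩ := exists_scheduler_le_iff.2 (minMax_limIter_le (M := M) he h)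
      exact ⟨ρ, fun _ => hρ⟩
    · exact ⟨ρ s, fun h' => absurd h' h⟩
  choose ρ₀ hρ₀ using h1
  let σ : M.Scheduler := fun τ => if τ.last ∈ X then ρ τ.last else ρ₀ τ.last
  have hle : ∀ (π : M.Nature) (ω : FinPath S), limVal D e σ π ω ≤ V ω.last := by
    intro π
    refine limVal_le_of_step_le (fun s => (isValueOp_minMax.limIter_mem he s).1)
      (fun s h => (limIter_of_notMem h).ge) fun τ hτ => ?_
    have ht := transition_stepProb σ π τ
    by_cases h : τ.last ∈ X
    · simp only [σ, if_pos h] at ht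
      exact (hX _ h).2.1 _ ht
    · simp only [σ, if_neg h] at ht
      exact hρ₀ _ hτ _ ht
  refine ⟨σ, fun π ω => ⟨hle π ω, ?_⟩⟩
  suffices ∀ n, ∀ ω : FinPath S, ω.last ∈ X → r ω.last = n → limVal D e σ π ω < V ω.last from
    fun h => this _ ω h rfl
  intro n
  induction n using Nat.strong_induction_on with
  | _ n ih =>
    intro ω hω hr
    refine (hle π ω).lt_of_ne fun heq => ?_
    -- If nature attains `V` at `τ`, it also does so after every successor of positive probability.
    -- The outer induction then excludes a drop of the rank, so the play stays in `X ⊆ D` and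
    -- collects nothing.
    have hzero : ∀ k, ∀ τ : FinPath S, τ.last ∈ X → r τ.last ≤ n → limVal D e σ π τ = V τ.last →
        val (stopRule D e) σ π k τ = 0 := by
      intro k
      induction k with
      | zero => exact fun τ hτ _ _ => val_stopRule_zero (hX _ hτ).1.1
      | succ k ihk =>
        intro τ hτ hrτ hτV
        obtain ⟨⟨hD, -⟩, hopt, htrap⟩ := hX _ hτ
        have hm := stepProb_mem σ π τ
        have ht : M.Transition τ.last (ρ τ.last) (M.stepProb σ π τ) := by
          have := transition_stepProb σ π τ
          simpa only [σ, if_pos hτ] using this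
        have hsucc : ∀ s, limVal D e σ π (τ.snoc s) ≤ V s := fun s => by
          simpa using hle π (τ.snoc s)
        rw [limVal_of_mem he hD] at hτV
        have hcons : M.stepProb σ π τ ⬝ᵥ V = V τ.last :=
          le_antisymm (hopt _ ht) (hτV.symm.trans_le (dotProduct_mono hm.1 fun s _ => hsucc s))
        have heqs : ∀ s, 0 < M.stepProb σ π τ s → limVal D e σ π (τ.snoc s) = V s := by
          intro s hs
          by_contra hne
          have := dotProduct_strictMono hm.1 (fun s _ => hsucc s)
            ⟨s, hs, (hsucc s).lt_of_ne hne⟩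
          rw [hτV, hcons] at this
          exact lt_irrefl _ this
        rw [val_stopRule_succ hD]
        rcases htrap _ ht hcons with ⟨y, hy, hry, hpos⟩ | ⟨-, hall⟩
        · have := ih _ (hry.trans_le hrτ) (τ.snoc y) (by simpa using hy) (by simp)
          rw [FinPath.last_snoc] at this
          exact absurd (heqs y hpos) this.ne
        · refine Finset.sum_eq_zero fun s _ => ?_
          rcases (hm.1 s).eq_or_lt with h0 | h0
          · rw [← h0, zero_mul]
          · obtain ⟨hsX, hrs⟩ := hall s h0
            dsimp only
            rw [ihk (τ.snoc s) (by simpa using hsX) (by simpa using hrs.trans hrτ)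
              (by simpa using heqs s h0), mul_zero]
    have h0 : limVal D e σ π ω = 0 := by
      simp [limVal, hzero _ ω hω hr.le heq]
    exact (hX _ hω).1.2.ne' (heq.symm.trans h0)

/-- If `ρ` is optimal, then so is every action in its support. -/
lemma le_of_mem_support (he : ∀ s, e s ∈ Set.Icc (0 : ℝ) 1) {x : S} (hx : x ∈ D)
    {ρ : stdSimplex ℝ A}
    (hρ : ∀ μ, M.Transition x ρ μ → μ ⬝ᵥ limIter D e M.minMax ≤ limIter D e M.minMax x) {a : A}
    (ha : 0 < ρ.1 a) {μ : S → ℝ} (hμ : μ ∈ M.feasible x a) :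
    μ ⬝ᵥ limIter D e M.minMax ≤ limIter D e M.minMax x := by
  classical
  set V := limIter D e M.minMax with hV
  by_contra! hlt
  -- `η` is nature's gain from answering `a` by `μ`. Answers to the other actions that fall short of
  -- `V x` by less than `η` keep the total above `V x`.
  set η := ρ.1 a * (μ ⬝ᵥ V - V x) with hη
  have hη0 : 0 < η := mul_pos ha (sub_pos.2 hlt)
  have h1 : V x - η < M.minMax V x := by
    linarith [(isValueOp_minMax (M := M)).limIter_le_op (D := D) he hx]
  choose m hm hlt' using lt_minMax_iff.1 h1
  have h2 := hρ _ ⟨Function.update m a μ, fun b => by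
    by_cases hb : b = a
    · subst hb
      simpa using hμ
    · simpa [hb] using hm b, fun _ => rfl⟩
  rw [sum_mul_dotProduct] at h2
  have h3 : ρ.1 ⬝ᵥ (fun b => (if b = a then μ ⬝ᵥ V - V x + η else 0) + (V x - η)) ≤
      ∑ b, ρ.1 b * (Function.update m a μ b ⬝ᵥ V) := by
    refine dotProduct_mono ρ.2.1 fun b _ => ?_
    by_cases hb : b = a
    · subst hb
      simp
    · simp [hb, (hlt' b).le]
  rw [dotProduct_add_const ρ.2] at h3
  have h4 : (ρ.1 ⬝ᵥ fun b => if b = a then μ ⬝ᵥ V - V x + η else 0) =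
      ρ.1 a * (μ ⬝ᵥ V - V x + η) := by
    simp [dotProduct]
  rw [h4, mul_add, ← hη] at h3
  linarith [mul_pos ha hη0]

/-- Outside a maximal trap for `V`, nature can achieve the optimal value `V`. -/
lemma exists_nature_le_limVal_of_notMem (he : ∀ s, e s ∈ Set.Icc (0 : ℝ) 1)
    (hX : ∀ Y ⊆ (D ∩ {s | 0 < limIter D e M.minMax s}) \ X, Y.Nonempty →
      ∃ y ∈ Y, ∀ ρ : stdSimplex ℝ A,
        (∀ μ, M.Transition y ρ μ → μ ⬝ᵥ limIter D e M.minMax ≤ limIter D e M.minMax y) →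
        ∃ μ, M.Transition y ρ μ ∧ μ ⬝ᵥ limIter D e M.minMax = limIter D e M.minMax y ∧
          (∀ x ∈ X, ¬ 0 < μ x) ∧ (True → ∃ z ∉ Y, 0 < μ z))
    {s : S} (hs : s ∉ X) (σ : M.Scheduler) :
    ∃ π : M.Nature, limIter D e M.minMax s ≤ limVal D e σ π ⟨0, fun _ => s⟩ := by
  classical
  set V := limIter D e M.minMax with hV
  -- a rank on the states where nature has to make progress
  let H : Finset S := Finset.univ.filter fun y => y ∈ (D ∩ {s | 0 < V s}) \ X
  have hH : ∀ y, y ∈ H ↔ y ∈ (D ∩ {s | 0 < V s}) \ X := fun y => by simp [H]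
  let opt : S → A → Prop := fun y a => ∀ μ ∈ M.feasible y a, μ ⬝ᵥ V ≤ V y
  obtain ⟨q, hq0, hq⟩ := exists_rank (H := H)
    (Prog := fun y Z => ∀ a, opt y a → ∃ μ ∈ M.feasible y a, μ ⬝ᵥ V = V y ∧
      (∀ x ∈ X, ¬ 0 < μ x) ∧ ∃ z ∈ Z, 0 < μ z)
    (fun y Z Z' hZ h a ha => by
      obtain ⟨μ, h1, h2, h3, z, hz, h4⟩ := h a ha
      exact ⟨μ, h1, h2, h3, z, hZ hz, h4⟩)
    (fun Y hY hne => by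
      obtain ⟨y, hy, h⟩ := hX Y (fun y hyY => (hH y).1 (hY hyY)) hne
      refine ⟨y, hy, fun a ha => ?_⟩
      obtain ⟨ρ, hρ⟩ := exists_dirac (M := M) y a
      obtain ⟨μ, h1, h2, h3, h4⟩ := h ρ fun μ hμ => ha μ (hρ μ hμ)
      exact ⟨μ, hρ μ h1, h2, h3, h4 trivial⟩)
  let χ : S → S → ℝ := fun y z => if q z < q y then 1 else 0
  have h1 : ∀ y a, ∃ m : M.feasible y a, y ∈ H → opt y a → m.1 ⬝ᵥ V = V y ∧
      (∀ x ∈ X, ¬ 0 < m.1 x) ∧ 0 < m.1 ⬝ᵥ χ y := by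
    intro y a
    by_cases h : y ∈ H ∧ opt y a
    · obtain ⟨μ, h1, h2, h3, z, hz, h4⟩ := hq y h.1 a h.2
      refine ⟨⟨μ, h1⟩, fun _ _ => ⟨h2, h3, ?_⟩⟩
      have hz' : q z < q y := hz
      have := dotProduct_strictMono (u := fun _ => 0) (v := χ y) h1.1.1
        (fun z _ => by simp only [χ]; split_ifs <;> norm_num) ⟨z, h4, by simp [χ, hz']⟩
      rwa [dotProduct_const h1.1] at this
    · exact ⟨⟨_, (M.feasible_nonempty' y a).choose_spec⟩, fun h1 h2 => absurd ⟨h1, h2⟩ h⟩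
  choose m hm using h1
  obtain ⟨ε, ⟨hε0, hε1⟩, hε⟩ : ∃ ε : ℝ, (0 < ε ∧ ε < 1) ∧ ∀ y a, y ∈ H → opt y a →
      ε ≤ (m y a).1 ⬝ᵥ χ y := by
    have : ∀ᶠ ε in 𝓝[>] (0 : ℝ), ∀ y a, y ∈ H → opt y a → ε ≤ (m y a).1 ⬝ᵥ χ y := by
      rw [eventually_all]
      intro y
      rw [eventually_all]
      intro a
      by_cases h : y ∈ H ∧ opt y a
      · filter_upwards [Ioo_mem_nhdsGT (hm y a h.1 h.2).2.2] with ε hε _ _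
        exact hε.2.le
      · exact Eventually.of_forall fun ε h1 h2 => absurd ⟨h1, h2⟩ h
    obtain ⟨ε, h1, h2⟩ := (Filter.Eventually.and (Ioo_mem_nhdsGT (zero_lt_one (α := ℝ))) this).exists
    exact ⟨ε, h1, h2⟩
  -- nature switches as soon as the value can be guaranteed
  let K : FinPath S → Prop := fun τ => ∃ π : M.Nature, V τ.last ≤ limVal D e σ π τ
  have hKH : ∀ τ, ¬ K τ → τ.last ∉ X → τ.last ∈ H := by
    intro τ hK hτX
    rw [hH]
    refine ⟨⟨by_contra fun h => hK ⟨Classical.arbitrary _, ?_⟩, ?_⟩, hτX⟩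
    · rw [limVal_of_notMem h, hV, limIter_of_notMem h]
    · change 0 < V τ.last
      by_contra! h
      exact hK ⟨Classical.arbitrary _, h.trans (limVal_mem he τ).1⟩
  have hK : ∀ τ, ¬ K τ → τ.last ∈ D → ∀ μ, M.Transition τ.last (σ τ) μ → μ ⬝ᵥ V ≤ V τ.last := by
    intro τ hK hD μ hμ
    by_contra! hlt
    obtain ⟨δ, hδ, hδ'⟩ := exists_between (sub_pos.2 hlt)
    have h1 : ∀ s, ∃ π : M.Nature, V s + -δ < limVal D e σ π (τ.snoc s) := fun s =>
      exists_nature_lt_limVal he (by rw [FinPath.last_snoc]; linarith) σ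
    choose f hf using h1
    obtain ⟨π, hπ, hπ'⟩ := exists_nature_branch hμ f
    refine hK ⟨π, ?_⟩
    rw [limVal_of_mem he hD, hπ]
    calc V τ.last ≤ μ ⬝ᵥ V + -δ := by linarith
      _ = μ ⬝ᵥ fun s => V s + -δ := (dotProduct_add_const hμ.mem _ _).symm
      _ ≤ μ ⬝ᵥ fun s => limVal D e σ π (τ.snoc s) := dotProduct_mono hμ.mem.1 fun s _ => by
        rw [limVal_congr fun g k => hπ' g k s]
        exact (hf s).le
  have h2 : ∀ τ, ∃ π : M.Nature, K τ → V τ.last ≤ limVal D e σ π τ := by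
    intro τ
    by_cases h : K τ
    · exact ⟨h.choose, fun _ => h.choose_spec⟩
    · exact ⟨Classical.arbitrary _, fun h' => absurd h' h⟩
  choose p hp using h2
  obtain ⟨π, live, hl0, hl, hlK⟩ := FinPath.exists_stitch
    (β := fun τ => ∀ a, M.feasible τ.last a) K (fun τ a => m τ.last a) p
  refine ⟨π, ?_⟩
  -- Preserving `V` is not enough, since the play might stay in `D` forever with payoff `0`. Until
  -- nature switches, each step lowers `q` with probability at least `ε`, so the supremum `Γ` of the
  -- gaps satisfies `Γ ≤ (1 - ε ^ N) * Γ`. Inserting `0` into `G` ensures `0 ≤ Γ`.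
  let gap : FinPath S → ℝ := fun τ => V τ.last - limVal D e σ π τ
  let G : Set ℝ := insert 0 (gap '' {τ | live τ ∧ τ.last ∉ X})
  have hG : BddAbove G := by
    refine ⟨1, ?_⟩
    rintro _ (rfl | ⟨τ, -, rfl⟩)
    · exact zero_le_one
    · have h1 := ((isValueOp_minMax (M := M)).limIter_mem (D := D) he τ.last).2
      have h2 := (limVal_mem (D := D) (σ := σ) (π := π) he τ).1
      simp only [gap]
      linarith
  set Γ := sSup G with hΓ
  have hΓ0 : 0 ≤ Γ := le_csSup hG (Set.mem_insert _ _)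
  have hgap : ∀ τ, live τ → τ.last ∉ X → gap τ ≤ Γ := fun τ h1 h2 =>
    le_csSup hG (Set.mem_insert_of_mem _ ⟨τ, ⟨h1, h2⟩, rfl⟩)
  have key : ∀ j, ∀ τ, live τ → τ.last ∉ X → q τ.last < j → gap τ ≤ (1 - ε ^ j) * Γ := by
    intro j
    induction j with
    | zero => exact fun τ _ _ h => absurd h (Nat.not_lt_zero _)
    | succ j ih =>
      intro τ hτ hτX hqτ
      by_cases hKτ : K τ
      · have h1 : limVal D e σ π τ = limVal D e σ (p τ) τ :=
          limVal_congr fun g k => val_congr k τ (fun _ _ => rfl) (hlK τ hτ hKτ)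
        have h2 : gap τ ≤ 0 := by
          simp only [gap, h1]
          linarith [hp τ hKτ]
        exact h2.trans (mul_nonneg (sub_nonneg.2 (pow_le_one₀ hε0.le hε1.le)) hΓ0)
      · obtain ⟨hπτ, hlive⟩ := hl τ hτ hKτ
        have hτH := hKH τ hKτ hτX
        have hD := ((hH _).1 hτH).1.1
        have hopt : ∀ a, 0 < (σ τ).1 a → opt τ.last a := fun a ha μ hμ =>
          le_of_mem_support he hD (hK τ hKτ hD) ha hμ
        set ν := M.stepProb σ π τ with hν
        have hνmem : ν ∈ stdSimplex ℝ S := stepProb_mem σ π τ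
        have hνeq : ν = fun s => ∑ a, (σ τ).1 a * (m τ.last a).1 s := by
          rw [hν]
          funext s
          simp only [stepProb, hπτ]
        have hνV : ν ⬝ᵥ V = V τ.last := by
          rw [hνeq, sum_mul_dotProduct, ← dotProduct_const (σ τ).2 (V τ.last)]
          exact le_antisymm
            (dotProduct_mono (σ τ).2.1 fun a ha => (hm _ a hτH (hopt a ha)).1.le)
            (dotProduct_mono (σ τ).2.1 fun a ha => (hm _ a hτH (hopt a ha)).1.ge)
        have hνX : ∀ x ∈ X, ¬ 0 < ν x := by
          intro x hx
          rw [hνeq, not_lt]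
          refine Finset.sum_nonpos fun a _ => ?_
          rcases ((σ τ).2.1 a).eq_or_lt with h0 | h0
          · rw [← h0, zero_mul]
          · exact mul_nonpos_of_nonneg_of_nonpos h0.le
              (not_lt.1 ((hm _ a hτH (hopt a h0)).2.1 x hx))
        have hνχ : ε ≤ ν ⬝ᵥ χ τ.last := by
          rw [hνeq, sum_mul_dotProduct, ← dotProduct_const (σ τ).2 ε]
          exact dotProduct_mono (σ τ).2.1 fun a ha => hε _ a hτH (hopt a ha)
        have hstep : gap τ = ν ⬝ᵥ fun s => gap (τ.snoc s) := by
          have : (fun s => gap (τ.snoc s)) = V - fun s => limVal D e σ π (τ.snoc s) := by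
            funext s
            simp [gap]
          rw [this, dotProduct_sub, hνV, hν, ← limVal_of_mem he hD]
        have hεj : 0 ≤ ε ^ j * Γ := mul_nonneg (pow_nonneg hε0.le j) hΓ0
        calc gap τ = ν ⬝ᵥ fun s => gap (τ.snoc s) := hstep
          _ ≤ ν ⬝ᵥ fun s => (-(ε ^ j * Γ) • χ τ.last) s + Γ := by
            refine dotProduct_mono hνmem.1 fun s hs => ?_
            have hsX : (τ.snoc s).last ∉ X := by
              rw [FinPath.last_snoc]
              exact fun h => hνX s h hs
            by_cases hqs : q s < q τ.last
            · have := ih (τ.snoc s) (hlive s) hsX (by rw [FinPath.last_snoc]; omega)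
              simp only [χ, Pi.smul_apply, if_pos hqs, smul_eq_mul]
              linarith
            · have := hgap (τ.snoc s) (hlive s) hsX
              simpa only [χ, Pi.smul_apply, if_neg hqs, smul_eq_mul, mul_zero, zero_add] using this
          _ = -(ε ^ j * Γ) * (ν ⬝ᵥ χ τ.last) + Γ := by
            rw [dotProduct_add_const hνmem, dotProduct_smul, smul_eq_mul]
          _ ≤ (1 - ε ^ (j + 1)) * Γ := by
            rw [pow_succ]
            nlinarith [mul_le_mul_of_nonneg_left hνχ hεj]
  obtain ⟨N, hN⟩ : ∃ N, ∀ x, q x < N := by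
    obtain ⟨N, hN⟩ := (Set.finite_range q).bddAbove
    exact ⟨N + 1, fun x => Nat.lt_succ_of_le (hN ⟨x, rfl⟩)⟩
  have hεN : 0 ≤ (1 - ε ^ N) * Γ := mul_nonneg (sub_nonneg.2 (pow_le_one₀ hε0.le hε1.le)) hΓ0
  have hΓle : Γ ≤ (1 - ε ^ N) * Γ := by
    refine csSup_le ⟨0, Set.mem_insert _ _⟩ ?_
    rintro _ (rfl | ⟨τ, ⟨h1, h2⟩, rfl⟩)
    · exact hεN
    · exact key N τ h1 h2 (hN _)
  have hΓ1 : Γ ≤ 0 := by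
    have := pow_pos hε0 N
    by_contra! h
    nlinarith [mul_pos this h]
  have := (hgap ⟨0, fun _ => s⟩ (hl0 _) hs).trans hΓ1
  simp only [gap] at this
  change V s - _ ≤ 0 at this
  linarith

end StrictMax

/-- Bisimilar states satisfy the same probabilistic reachability properties. -/
lemma IsBisimulation.infinite_horizon (hR : M.IsBisimulation R) {D : Set S} {e : S → ℝ}
    (hD : ∀ x y, R x y → (x ∈ D ↔ y ∈ D)) (heR : ∀ x y, R x y → e x = e y)
    (he : ∀ s, e s ∈ Set.Icc (0 : ℝ) 1) {s t : S} (h : R s t) (r : Comparison) (p : ℝ)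
    (hs : ∃ σ : M.Scheduler, ∀ π : M.Nature, r.Rel (limVal D e σ π ⟨0, fun _ => s⟩) p) :
    ∃ σ : M.Scheduler, ∀ π : M.Nature, r.Rel (limVal D e σ π ⟨0, fun _ => t⟩) p := by
  obtain ⟨σ, hσ⟩ := hs
  have : Nonempty A := by
    by_contra hA
    rw [not_nonempty_iff] at hA
    simpa using (σ ⟨0, fun _ => s⟩).2.2
  have hV := limIter_eq_of_rel (O := M.minMax) hD heR
    fun u hu x y h => hR.minMax_eq hu h
  have hW := limIter_eq_of_rel (O := M.maxMin 1) hD heR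
    fun u hu x y h => hR.maxMin_eq 1 hu h
  -- Where `V` vanishes every nature attains it, so this trap is sought only where `V` is positive.
  obtain ⟨X, k, ρ, hX, hXR, hmax⟩ := hR.exists_trap
    (D := D ∩ {s | 0 < limIter D e M.minMax s}) hV
    (fun x y h => by simp [hD x y h, hV x y h]) True
  obtain ⟨X', k', ρ', hX', hXR', hmax'⟩ := hR.exists_trap
    (u := -limIter D e (M.maxMin 1)) (fun x y h => by simp [hW x y h]) hD False
  obtain ⟨σV, hσV⟩ := hX.exists_scheduler_limVal_lt he
  obtain ⟨σW, hσW⟩ := exists_scheduler_le_limVal (M := M) (D := D) he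
  cases r with
  | le =>
    have h1 : limIter D e M.minMax s ≤ p := by
      by_contra! hlt
      obtain ⟨π, hπ⟩ := exists_nature_lt_limVal (ω := ⟨0, fun _ => s⟩) he hlt σ
      exact hπ.not_ge (hσ π)
    exact ⟨σV, fun π => ((hσV π ⟨0, fun _ => t⟩).1.trans_eq (hV s t h).symm).trans h1⟩
  | lt =>
    have h1 : limIter D e M.minMax s ≤ p := by
      by_contra! hlt
      obtain ⟨π, hπ⟩ := exists_nature_lt_limVal (ω := ⟨0, fun _ => s⟩) he hlt σ
      exact hπ.not_gt (hσ π)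
    rcases h1.lt_or_eq with h1 | h1
    · exact ⟨σV, fun π => ((hσV π ⟨0, fun _ => t⟩).1.trans_eq (hV s t h).symm).trans_lt h1⟩
    -- With the threshold equal to the value, `σ` beats the value against every nature. This is
    -- possible only inside the trap, whose invariance then covers `t`.
    · have hsX : s ∈ X := by
        by_contra hsX
        obtain ⟨π, hπ⟩ := exists_nature_le_limVal_of_notMem he hmax hsX σ
        exact (h1.symm.trans_le hπ).not_gt (hσ π)
      exact ⟨σV, fun π => ((hσV π ⟨0, fun _ => t⟩).2 (hXR s t h hsX)).trans_eq
        ((hV s t h).symm.trans h1)⟩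
  | ge =>
    have h1 : p ≤ limIter D e (M.maxMin 1) s := by
      by_contra! hlt
      obtain ⟨c, hc, hc'⟩ := exists_between hlt
      obtain ⟨π, hπ⟩ := exists_nature_limVal_le he ⟨0, fun _ => s⟩ hc σ
      exact (hπ.trans_lt hc').not_ge (hσ π)
    exact ⟨σW, fun π => (h1.trans_eq (hW s t h)).trans (hσW π ⟨0, fun _ => t⟩)⟩
  | gt =>
    have h1 : p ≤ limIter D e (M.maxMin 1) s := by
      by_contra! hlt
      obtain ⟨π, hπ⟩ := exists_nature_limVal_le he ⟨0, fun _ => s⟩ hlt σ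
      exact hπ.not_gt (hσ π)
    rcases h1.lt_or_eq with h1 | h1
    · exact ⟨σW, fun π => (h1.trans_eq (hW s t h)).trans_le (hσW π ⟨0, fun _ => t⟩)⟩
    · have hsX : s ∈ X' := by
        by_contra hsX
        obtain ⟨π, hπ⟩ := exists_nature_limVal_le_of_notMem he hmax' hsX σ
        exact (hπ.trans_eq h1.symm).not_gt (hσ π)
      obtain ⟨σ', hσ'⟩ := hX'.exists_scheduler_lt_limVal he _ ⟨0, fun _ => t⟩
        (hXR' s t h hsX) (Nat.lt_succ_self _)
      exact ⟨σ', fun π => (h1.trans (hW s t h)).trans_lt (hσ' π)⟩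

/-! ### Path formulas as games, and the induction on formulas. -/

section PCTL

set_option linter.unusedSectionVars false

variable [MeasurableSpace S] [DiscreteMeasurableSpace S]

/-- The infinite paths that reach `G` within `k` steps after time `n`, and stay in `B` before. -/
def boundedUntil (B G : Set S) (k n : ℕ) : Set (ℕ → S) :=
  {w | ∃ i ≤ k, w (n + i) ∈ G ∧ ∀ j < i, w (n + j) ∈ B}

lemma boundedUntil_of_mem {B G : Set S} {k n : ℕ} {w : ℕ → S} (h : w n ∈ G) :
    w ∈ boundedUntil B G k n :=
  ⟨0, Nat.zero_le _, h, fun j hj => absurd hj (Nat.not_lt_zero j)⟩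

lemma boundedUntil_zero_iff {B G : Set S} {n : ℕ} {w : ℕ → S} :
    w ∈ boundedUntil B G 0 n ↔ w n ∈ G := by
  refine ⟨?_, boundedUntil_of_mem⟩
  rintro ⟨i, hi, hG, -⟩
  obtain rfl := Nat.le_zero.1 hi
  exact hG

lemma boundedUntil_succ_iff {B G : Set S} {k n : ℕ} {w : ℕ → S} (h : w n ∉ G) :
    w ∈ boundedUntil B G (k + 1) n ↔ w n ∈ B ∧ w ∈ boundedUntil B G k (n + 1) := by
  constructor
  · rintro ⟨i, hi, hG, hB⟩
    cases i with
    | zero => exact absurd hG h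
    | succ i =>
      refine ⟨hB 0 (Nat.succ_pos i), i, Nat.le_of_succ_le_succ hi, ?_, fun j hj => ?_⟩
      · rwa [Nat.add_right_comm, add_assoc]
      · rw [Nat.add_right_comm, add_assoc]
        exact hB _ (Nat.succ_lt_succ hj)
  · rintro ⟨hB0, i, hi, hG, hB⟩
    refine ⟨i + 1, Nat.succ_le_succ hi, ?_, fun j hj => ?_⟩
    · rwa [Nat.add_right_comm, add_assoc] at hG
    · cases j with
      | zero => exact hB0
      | succ j =>
        have := hB j (Nat.lt_of_succ_lt_succ hj)
        rwa [Nat.add_right_comm, add_assoc] at this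

-- The outcome is decided on leaving `B \ G`: won in `G`, lost elsewhere. A horizon that runs out
-- inside `B \ G` counts as lost.
open Classical in
lemma pathMeasure_boundedUntil (B G : Set S) (s : S) (σ : M.Scheduler) (π : M.Nature) (k : ℕ) :
    (M.pathMeasure s σ π).real (boundedUntil B G k 0) =
      val (stopRule (B \ G) fun x => if x ∈ G then 1 else 0) σ π k ⟨0, fun _ => s⟩ := by
  refine pathMeasure_real_eq_val s σ π _ (boundedUntil B G) (fun n w => ?_) (fun k n w r hr => ?_)
    (fun k n w hn => ?_) k
  · rw [boundedUntil_zero_iff]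
    by_cases hG : w n ∈ G
    · simp [stopRule, hG]
    · by_cases hB : w n ∈ B <;> simp [stopRule, hG, hB]
  · by_cases hG : w n ∈ G
    · have h1 : w ∈ boundedUntil B G (k + 1) n := boundedUntil_of_mem hG
      simp only [stopRule, Set.mem_sdiff, hG, not_true, and_false, if_false, if_true,
        Option.some.injEq] at hr
      exact ⟨fun _ => hr.symm, fun h => absurd h1 h⟩
    · rw [boundedUntil_succ_iff hG]
      by_cases hB : w n ∈ B
      · simp [stopRule, hB, hG] at hr
      · simp only [stopRule, Set.mem_sdiff, hG, hB, false_and, if_false, Option.some.injEq] at hr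
        exact ⟨fun h => absurd h.1 hB, fun _ => hr.symm⟩
  · have hBG : w n ∈ B \ G := by
      by_contra h
      simp [stopRule, h] at hn
    rw [boundedUntil_succ_iff hBG.2]
    exact and_iff_right hBG.1

open Classical in
lemma pathMeasure_until (B G : Set S) (s : S) (σ : M.Scheduler) (π : M.Nature) :
    (M.pathMeasure s σ π).real (⋃ k, boundedUntil B G k 0) =
      limVal (B \ G) (fun x => if x ∈ G then 1 else 0) σ π ⟨0, fun _ => s⟩ := by
  have hmono : Monotone fun k => boundedUntil B G k 0 := fun k l hkl w ⟨i, hi, h⟩ =>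
    ⟨i, hi.trans hkl, h⟩
  have h1 := (ENNReal.tendsto_toReal (measure_ne_top (M.pathMeasure s σ π) _)).comp
    (tendsto_measure_iUnion_atTop (μ := M.pathMeasure s σ π) hmono)
  refine tendsto_nhds_unique h1 ?_
  have h2 := tendsto_val_stopRule (D := B \ G) (e := fun x => if x ∈ G then 1 else 0) (σ := σ)
    (π := π) (fun x => by split_ifs <;> simp) ⟨0, fun _ => s⟩
  refine h2.congr fun k => ?_
  rw [← pathMeasure_boundedUntil]
  rfl

-- The rule stops exactly when the remaining horizon is `0`, so horizon `1` inspects the state after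
-- one step.
open Classical in
lemma pathMeasure_next (G : Set S) (s : S) (σ : M.Scheduler) (π : M.Nature) :
    (M.pathMeasure s σ π).real {w | w 1 ∈ G} =
      val (fun k x => if k = 0 then some (if x ∈ G then 1 else 0) else none) σ π 1
        ⟨0, fun _ => s⟩ := by
  have := pathMeasure_real_eq_val (M := M) s σ π
    (fun k x => if k = 0 then some (if x ∈ G then 1 else 0) else none)
    (fun k n => {w | w (n + k) ∈ G})
    (fun n w => by
      change (w (n + 0) ∈ G → _) ∧ (w (n + 0) ∉ G → _)
      by_cases h : w n ∈ G <;> simp [h])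
    (fun k n w r hr => by simp at hr)
    (fun k n w _ => by
      change w (n + (k + 1)) ∈ G ↔ w (n + 1 + k) ∈ G
      rw [Nat.add_right_comm, add_assoc]) 1
  simpa using this

lemma sat_prob_iff {ψ : PCTL AP .path} {E : Set (ℕ → S)} (hE : ∀ w : ℕ → S, M.Sat ψ w ↔ w ∈ E)
    {v : S → M.Scheduler → M.Nature → ℝ} (hv : ∀ s σ π, (M.pathMeasure s σ π).real E = v s σ π)
    {r : Comparison} {p : Set.Icc (0 : ℚ) 1} {s : S} :
    M.Sat (.prob r p ψ) s ↔
      ∃ σ : M.Scheduler, ∀ π : M.Nature, r.Rel (v s σ π) ((p : ℚ) : ℝ) := by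
  have hset : {w : ℕ → S | M.Sat ψ w} = E := Set.ext hE
  change (∃ σ : M.Scheduler, ∀ π : M.Nature,
    r.Rel ((M.pathMeasure s σ π).real {w : ℕ → S | M.Sat ψ w}) ((p : ℚ) : ℝ)) ↔ _
  simp only [hset, hv]

/-- Invariance of PCTL formulas under `R`: state formulas are invariant under `R`, and so are the
probabilistic state formulas made from path formulas. -/
def RespectsRel (M : IMDP S A AP) (R : Setoid S) : {κ : FormulaKind} → PCTL AP κ → Prop
  | .state, φ => ∀ s t, R s t → (M.Sat φ s ↔ M.Sat φ t)
  | .path, ψ => ∀ s t, R s t → ∀ (r : Comparison) (p : Set.Icc (0 : ℚ) 1),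
      M.Sat (.prob r p ψ) s → M.Sat (.prob r p ψ) t

lemma IsBisimulation.respectsRel (hR : M.IsBisimulation R) {κ : FormulaKind} (φ : PCTL AP κ) :
    M.RespectsRel R φ := by
  classical
  induction φ with
  | tt => exact fun s t _ => Iff.rfl
  | atom x =>
    intro s t h
    change x ∈ M.label s ↔ x ∈ M.label t
    rw [(hR s t h).1]
  | neg φ ih => exact fun s t h => not_congr (ih s t h)
  | and φ₁ φ₂ ih₁ ih₂ => exact fun s t h => and_congr (ih₁ s t h) (ih₂ s t h)
  | prob r p ψ ih => exact fun s t h => ⟨ih s t h r p, ih t s (R.symm h) r p⟩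
  | next φ ih =>
    intro s t h r p hs
    have key := fun s => sat_prob_iff (M := M) (r := r) (p := p) (s := s) (ψ := .next φ)
      (fun _ => Iff.rfl) (pathMeasure_next {x : S | M.Sat φ x})
    refine (key t).2 (hR.finite_horizon (fun k x y hxy => ?_) 1 h r _ ((key s).1 hs))
    have hφ : y ∈ {x : S | M.Sat φ x} ↔ x ∈ {x : S | M.Sat φ x} := (ih x y hxy).symm
    simp only [hφ]
  | boundedTil k φ₁ φ₂ ih₁ ih₂ =>
    intro s t h r p hs
    have key := fun s => sat_prob_iff (M := M) (r := r) (p := p) (s := s)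
      (ψ := .boundedTil k φ₁ φ₂)
      (E := boundedUntil {x : S | M.Sat φ₁ x} {x : S | M.Sat φ₂ x} k 0)
      (fun w => by simp only [boundedUntil, Nat.zero_add]; exact Iff.rfl)
      (fun s σ π => pathMeasure_boundedUntil _ _ s σ π k)
    refine (key t).2 (hR.finite_horizon (fun k x y hxy => ?_) k h r _ ((key s).1 hs))
    have h₁ : y ∈ {x : S | M.Sat φ₁ x} ↔ x ∈ {x : S | M.Sat φ₁ x} := (ih₁ x y hxy).symm
    have h₂ : y ∈ {x : S | M.Sat φ₂ x} ↔ x ∈ {x : S | M.Sat φ₂ x} := (ih₂ x y hxy).symm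
    simp only [stopRule, Set.mem_sdiff, h₁, h₂]
  | til φ₁ φ₂ ih₁ ih₂ =>
    intro s t h r p hs
    have key := fun s => sat_prob_iff (M := M) (r := r) (p := p) (s := s) (ψ := .til φ₁ φ₂)
      (E := ⋃ k, boundedUntil {x : S | M.Sat φ₁ x} {x : S | M.Sat φ₂ x} k 0)
      (fun w => by simp only [boundedUntil, Nat.zero_add, Set.mem_iUnion]; exact Iff.rfl)
      (pathMeasure_until _ _)
    have h₁ : ∀ x y, R x y → (x ∈ {x : S | M.Sat φ₁ x} ↔ y ∈ {x : S | M.Sat φ₁ x}) := ih₁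
    have h₂ : ∀ x y, R x y → (x ∈ {x : S | M.Sat φ₂ x} ↔ y ∈ {x : S | M.Sat φ₂ x}) := ih₂
    refine (key t).2 (hR.infinite_horizon (fun x y hxy => ?_) (fun x y hxy => ?_) (fun x => ?_)
      h r _ ((key s).1 hs))
    · simp only [Set.mem_sdiff, h₁ x y hxy, h₂ x y hxy]
    · simp only [h₂ x y hxy]
    · split_ifs <;> simp

end PCTL

end IMDP

theorem mainTheorem2 {S A AP : Type*} [Fintype S] [Fintype A] [Finite AP]
    [MeasurableSpace S] [DiscreteMeasurableSpace S]
    (M : IMDP S A AP) (s t : S) (hst : M.Bisimilar s t) (φ : PCTL AP .state) :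
    M.Sat φ s ↔ M.Sat φ t := by
  obtain ⟨R, hR, h⟩ := hst
  exact hR.respectsRel φ s t h
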